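/- **Setting.** Let $E$ and $H\neq\{0\}$ be finite-dimensional real vector spaces, $K\subset E$ a regular cone (closed, convex, pointed, with nonempty interior) with dual cone $K^*\subset E^*$, and $F$ a $\nu$-normal barrier for $K$: a three times continuously differentiable convex function on $\operatorname{int}K$ that tends to $+\infty$ at the boundary of $K$, with $|\nabla^3F(x)[h,h,h]|\le 2\langle\nabla^2F(x)h,h\rangle^{3/2}$ and $F(\tau x)=F(x)-\nu\ln\tau$ for $x\in\operatorname{int}K$, $h\in E$, $\tau>0$. Let $F_*(s)=\max_{x\in\operatorname{int}K}\{-\langle s,x\rangle-F(x)\}$ be the dual barrier on $\operatorname{int}K^*$. Let $A:E\to H^*$ be linear and surjective, $b\in H^*$, $c\in E^*$; put $s(y)=c-A^*y$, $Q=\{y\in H: s(y)\in K^*\}$, $f^*=\max_{y\in Q}\langle b,y\rangle$ and $f(y)=F_*(c-A^*y)$ for $y\in\operatorname{int}Q$. Assume strict feasibility: there are $x_0\in\operatorname{int}K$, $s_0\in\operatorname{int}K^*$, $y_0\in H$ with $Ax_0=b$ and $s_0+A^*y_0=c$. For $t>0$ let $(x_t,s_t,y_t)$ be the point of the primal-dual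 central path, i.e. the solution of $x_t\in\operatorname{int}K$, $Ax_t=b$, $c+t\nabla F(x_t)=A^*y_t$, $s_t=-t\nabla F(x_t)$. Put $B=\nabla^2F(x_1)$, $G=AB^{-1}A^*$, $\|h\|_B=\langle Bh,h\rangle^{1/2}$ for $h\in E$ and $\|h\|_G=\langle Gh,h\rangle^{1/2}$ for $h\in H$. For $y\in\operatorname{int}Q$ put $\|h\|_y=\langle\nabla^2f(y)h,h\rangle^{1/2}$ for $h\in H$ and $\|g\|_y=\langle g,[\nabla^2f(y)]^{-1}g\rangle^{1/2}$ for $g\in H^*$. Let $y_*$ be an optimal solution of $\max_{y\in Q}\langle b,y\rangle$, let $s_*=s(y_*)$, and suppose that there are constants $\gamma_d>0$ and $\sigma_d$ with $$f^*-\langle b,y\rangle\ge\gamma_d\|y-y_*\|_G\quad(y\in Q),\qquad \|\nabla^2F_*(s_t)s_*\|_B\le\sigma_d\quad(0<t\le1).$$ **Theorem.** Let $\mu\in(0,1]$, $\beta\in[0,\tfrac19]$, and let $y\in\mathcal N(\mu,\beta)$, i.e. $y\in\operatorname{int}Q$ and $\|\nabla f(y)-\tfrac1\mu b\|_y\le\beta$.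 Let $$\kappa=\kappa_1\kappa_2,\qquad \kappa_1=\nu+\frac{\beta(\beta+\sqrt\nu)}{1-\beta},\qquad \kappa_2=\frac{2}{\gamma_d}\Bigl(\sigma_d+\frac{6\nu^2}{\mu}\beta\Bigr),$$ let $v(y)=[\nabla^2f(y)]^{-1}\nabla f(y)$, and let $\bar\alpha=\bar\alpha(y)\in[0,+\infty]$ be the maximal feasible step along $v(y)$, that is, the supremum of all $\alpha\ge0$ with $y+\alpha v(y)\in Q$. Then $$1-\bar\alpha\le\frac{\kappa\mu}{1+\kappa\mu}.$$ If moreover $\kappa\mu<1-2\beta$ (that is, $\mu<(1-2\beta)/\kappa$ when $\kappa>0$), then $\bar\alpha$ is finite and attained, $$\bar\alpha-1\le\frac{\kappa\mu}{1-\kappa\mu-2\beta},$$ and the point $y(\bar\alpha)=y+\bar\alpha v(y)$ satisfies $$\|y(\bar\alpha)-y_*\|_y\le\kappa\mu\left(1+\frac{\sqrt\nu}{1-\kappa\mu-2\beta}\right).$$ -/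

import Mathlib

open Set Filter Topology

namespace ConicIPM

noncomputable section

/-! ### Calculus on a finite-dimensional space

The gradient of `Φ` at `u` is `fderiv ℝ Φ u`, an element of the dual space. -/

section Calculus

variable {V : Type*} [NormedAddCommGroup V] [NormedSpace ℝ V]

/-- The Hessian `∇²Φ(u)`, as an operator from the space to its dual. -/
def hess (Φ : V → ℝ) (u : V) : V →L[ℝ] StrongDual ℝ V :=
  fderiv ℝ (fderiv ℝ Φ) u

/-- The third differential `∇³Φ(u)[h, h, h]`. -/
def third (Φ : V → ℝ) (u h : V) : ℝ :=
  fderiv ℝ (hess Φ) u h h h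

/-- The norm `‖h‖_B = ⟨B h, h⟩^{1/2}` given by a positive definite operator `B`. -/
def opNorm (B : V →L[ℝ] StrongDual ℝ V) (h : V) : ℝ :=
  Real.sqrt (B h h)

/-- The dual norm `‖g‖_B = ⟨g, B⁻¹ g⟩^{1/2}` on linear functionals. -/
def opDualNorm (B : V →L[ℝ] StrongDual ℝ V) (g : StrongDual ℝ V) : ℝ :=
  Real.sqrt (g (B.inverse g))

/-- The local norm `‖h‖_u = ⟨∇²Φ(u) h, h⟩^{1/2}`. -/
def localNorm (Φ : V → ℝ) (u h : V) : ℝ := opNorm (hess Φ u) h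

/-- The dual local norm `‖g‖_u = ⟨g, [∇²Φ(u)]⁻¹ g⟩^{1/2}`. -/
def localDualNorm (Φ : V → ℝ) (u : V) (g : StrongDual ℝ V) : ℝ :=
  opDualNorm (hess Φ u) g

/-- The canonical identification of the bidual of a finite-dimensional space with the space:
the inverse of the evaluation map `x ↦ (s ↦ s x)`. -/
def ofBidual (ξ : StrongDual ℝ (StrongDual ℝ V)) : V :=
  (NormedSpace.inclusionInDoubleDual ℝ V).inverse ξ

end Calculus

/-! ### Regular cones and normal barriers -/

section Cones

variable {E : Type*} [NormedAddCommGroup E] [NormedSpace ℝ E]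

/-- A regular cone: a closed convex pointed cone with nonempty interior. -/
structure IsRegularCone (K : Set E) : Prop where
  isClosed : IsClosed K
  convex : Convex ℝ K
  smul_mem : ∀ t : ℝ, 0 ≤ t → ∀ x ∈ K, t • x ∈ K
  pointed : ∀ x, x ∈ K → -x ∈ K → x = 0
  interior_nonempty : (interior K).Nonempty

/-- The dual cone `K* = {s : ⟨s, x⟩ ≥ 0 for all x ∈ K}`. -/
def dualCone (K : Set E) : Set (StrongDual ℝ E) :=
  {s | ∀ x ∈ K, 0 ≤ s x}

/-- `F` is a `ν`-normal barrier for `K`: a self-concordant function on `int K` (three times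
continuously differentiable, convex, tending to `+∞` at the boundary of `K`, and satisfying the
third-derivative inequality) which is `ν`-logarithmically homogeneous. -/
structure IsNormalBarrier (K : Set E) (ν : ℝ) (F : E → ℝ) : Prop where
  contDiffOn : ContDiffOn ℝ 3 F (interior K)
  convexOn : ConvexOn ℝ (interior K) F
  tendsto_frontier : ∀ x ∈ frontier K, Tendsto F (𝓝[interior K] x) atTop
  selfConcordant : ∀ x ∈ interior K, ∀ h : E,
    |third F x h| ≤ 2 * (hess F x h h) ^ (3 / 2 : ℝ)
  logHomogeneous : ∀ x ∈ interior K, ∀ τ : ℝ, 0 < τ → F (τ • x) = F x - ν * Real.log τ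

/-- The dual barrier `F_*(s) = max {-⟨s, x⟩ - F(x) : x ∈ int K}`, for `s ∈ int K*`. -/
def dualBarrier (K : Set E) (F : E → ℝ) (s : StrongDual ℝ E) : ℝ :=
  sSup ((fun x : E => -(s x) - F x) '' interior K)

end Cones

/-! ### The conic problem and its dual

The primal problem is `min {⟨c, x⟩ : A x = b, x ∈ K}` with `A : E → H*`. The adjoint
`A* : H → E*` is `A.flip`. -/

section Problem

variable {E H : Type*} [NormedAddCommGroup E] [NormedSpace ℝ E]
  [NormedAddCommGroup H] [NormedSpace ℝ H]

/-- The dual slack `s(y) = c - A* y`. -/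
def slack (A : E →L[ℝ] StrongDual ℝ H) (c : StrongDual ℝ E) (y : H) : StrongDual ℝ E :=
  c - A.flip y

/-- The dual feasible set `Q = {y : c - A* y ∈ K*}`. -/
def feasible (K : Set E) (A : E →L[ℝ] StrongDual ℝ H) (c : StrongDual ℝ E) : Set H :=
  {y | slack A c y ∈ dualCone K}

/-- The optimal value `f^* = max {⟨b, y⟩ : y ∈ Q}`. -/
def optValue (K : Set E) (A : E →L[ℝ] StrongDual ℝ H) (b : StrongDual ℝ H)
    (c : StrongDual ℝ E) : ℝ :=
  sSup (b '' feasible K A c)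

/-- `y` is an optimal solution of the dual problem. -/
def IsOptimal (K : Set E) (A : E →L[ℝ] StrongDual ℝ H) (b : StrongDual ℝ H)
    (c : StrongDual ℝ E) (y : H) : Prop :=
  y ∈ feasible K A c ∧ ∀ u ∈ feasible K A c, b u ≤ b y

/-- Strict feasibility of the primal and of the dual problem. -/
def StrictlyFeasible (K : Set E) (A : E →L[ℝ] StrongDual ℝ H) (b : StrongDual ℝ H)
    (c : StrongDual ℝ E) : Prop :=
  ∃ x₀ ∈ interior K, ∃ s₀ ∈ interior (dualCone K), ∃ y₀ : H,
    A x₀ = b ∧ s₀ + A.flip y₀ = c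

/-- The barrier `f(y) = F_*(c - A* y)` of the set `Q`. -/
def dualObjBarrier (K : Set E) (F : E → ℝ) (A : E →L[ℝ] StrongDual ℝ H)
    (c : StrongDual ℝ E) (y : H) : ℝ :=
  dualBarrier K F (slack A c y)

/-- The equations that define the point `(x_μ, s_μ, y_μ)` of the primal-dual central path. -/
def IsCentralPoint (K : Set E) (F : E → ℝ) (A : E →L[ℝ] StrongDual ℝ H) (b : StrongDual ℝ H)
    (c : StrongDual ℝ E) (μ : ℝ) (z : E × StrongDual ℝ E × H) : Prop :=
  z.1 ∈ interior K ∧ A z.1 = b ∧ c + μ • fderiv ℝ F z.1 = A.flip z.2.2 ∧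
    z.2.1 = -(μ • fderiv ℝ F z.1)

/-- The point `z_μ = (x_μ, s_μ, y_μ)` of the primal-dual central path, `μ > 0`. -/
def centralPath (K : Set E) (F : E → ℝ) (A : E →L[ℝ] StrongDual ℝ H) (b : StrongDual ℝ H)
    (c : StrongDual ℝ E) (μ : ℝ) : E × StrongDual ℝ E × H :=
  Classical.epsilon (IsCentralPoint K F A b c μ)

/-- The operator `B = ∇²F(x_μ)` with `μ = 1`. -/
def metricB (K : Set E) (F : E → ℝ) (A : E →L[ℝ] StrongDual ℝ H) (b : StrongDual ℝ H)
    (c : StrongDual ℝ E) : E →L[ℝ] StrongDual ℝ E :=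
  hess F (centralPath K F A b c 1).1

/-- The operator `G = A B⁻¹ A* : H → H*`. -/
def metricG (K : Set E) (F : E → ℝ) (A : E →L[ℝ] StrongDual ℝ H) (b : StrongDual ℝ H)
    (c : StrongDual ℝ E) : H →L[ℝ] StrongDual ℝ H :=
  A ∘L (metricB K F A b c).inverse ∘L A.flip

/-- The optimal solution `y_*` is sharp with constant `γ`:
`f^* - ⟨b, y⟩ ≥ γ ‖y - y_*‖_G` for all `y ∈ Q`. -/
def SharpDual (K : Set E) (F : E → ℝ) (A : E →L[ℝ] StrongDual ℝ H) (b : StrongDual ℝ H)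
    (c : StrongDual ℝ E) (γ : ℝ) (ystar : H) : Prop :=
  ∀ y ∈ feasible K A c,
    γ * opNorm (metricG K F A b c) (y - ystar) ≤ optValue K A b c - b y

/-- The bound `‖∇²F_*(s_t) s_*‖_B ≤ σ` along the central path, `0 < t ≤ 1`, where
`s_* = c - A* y_*`. -/
def BoundedDual (K : Set E) (F : E → ℝ) (A : E →L[ℝ] StrongDual ℝ H) (b : StrongDual ℝ H)
    (c : StrongDual ℝ E) (σ : ℝ) (ystar : H) : Prop :=
  ∀ t : ℝ, 0 < t → t ≤ 1 →
    opNorm (metricB K F A b c)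
      (ofBidual (hess (dualBarrier K F) (centralPath K F A b c t).2.1 (slack A c ystar))) ≤ σ

/-- The neighbourhood `N(μ, β)` of the central path: the strictly feasible `y` with
`‖∇f(y) - b / μ‖_y ≤ β`. -/
def nbhd (K : Set E) (F : E → ℝ) (A : E →L[ℝ] StrongDual ℝ H) (b : StrongDual ℝ H)
    (c : StrongDual ℝ E) (μ β : ℝ) : Set H :=
  {y | y ∈ interior (feasible K A c) ∧
    localDualNorm (dualObjBarrier K F A c) y
      (fderiv ℝ (dualObjBarrier K F A c) y - (1 / μ) • b) ≤ β}

/-- The predictor direction `v(y) = [∇²f(y)]⁻¹ ∇f(y)`. -/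
def predDir (K : Set E) (F : E → ℝ) (A : E →L[ℝ] StrongDual ℝ H)
    (c : StrongDual ℝ E) (y : H) : H :=
  (hess (dualObjBarrier K F A c) y).inverse (fderiv ℝ (dualObjBarrier K F A c) y)

/-- The feasible steps `α ≥ 0` along `v(y)`: those with `y + α v(y) ∈ Q`. -/
def feasibleSteps (K : Set E) (F : E → ℝ) (A : E →L[ℝ] StrongDual ℝ H)
    (c : StrongDual ℝ E) (y : H) : Set ℝ :=
  {α | 0 ≤ α ∧ y + α • predDir K F A c y ∈ feasible K A c}

/-- The maximal feasible step along `v(y)`, equal to `+∞` if all steps are feasible. -/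
def maxStep (K : Set E) (F : E → ℝ) (A : E →L[ℝ] StrongDual ℝ H)
    (c : StrongDual ℝ E) (y : H) : EReal :=
  sSup ((fun α : ℝ => (α : EReal)) '' feasibleSteps K F A c y)

end Problem

/-- `κ₁ = ν + β (β + √ν) / (1 - β)`. -/
def kappa1 (ν β : ℝ) : ℝ := ν + β * (β + Real.sqrt ν) / (1 - β)

/-- `κ₂ = (2 / γ) (σ + 6 ν² β / μ)`. -/
def kappa2 (ν γ σ μ β : ℝ) : ℝ := 2 / γ * (σ + 6 * ν ^ 2 / μ * β)

/-- `κ = κ₁ κ₂`. -/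
def kappa (ν γ σ μ β : ℝ) : ℝ := kappa1 ν β * kappa2 ν γ σ μ β

end

end ConicIPM

/-! Write `M` for the Hessian of `f` at `y`, `s` for the slack of `y`, and `ρ = κ μ`. Let `x(s)` in
the interior of `K` be the point with `-∇F(x(s)) = s`. Then `∇²F_*(s) = [∇²F(x(s))]⁻¹`, `∇f(y) = A
x(s)` and `M = A ∇²F_*(s) A*`. Logarithmic homogeneity gives `∇²F_*(s) s = x(s)`, and so the full
predictor step misses the solution by exactly `y + v(y) - y_* = M⁻¹ A ∇²F_*(s) s_*`
(`add_predDir_sub`).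

This error has local norm at most `ρ`. By sharpness, and since the Dikin ellipsoid at `y` is
feasible, `‖·‖_G ≤ (κ₁ μ / γ) ‖·‖_y` (`opNorm_metricG_le`), because the optimality gap at `y` is at
most `κ₁ μ` (`nbhd_estimates`). Dually, the error is at most `κ₁ μ / γ` times `‖∇²F_*(s) s_*‖_B`.
The hypothesis bounds that norm by `σ` on the central path, and passing from `s_μ` to `s` costs `12
ν² β / μ` (`opNorm_inverse_slack_le`), by self-concordant stability of the Hessian
(`opNorm_inverse_sub_le`) and a comparison of the metrics at `x_1` and `x_μ / μ`
(`opNorm_le_mul_opNorm`).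

The rest is geometry. A convex combination of `y_*` with a point of the Dikin ellipsoid makes the
step `1 / (1 + ρ)` feasible (`one_div_step_mem`). A sharp solution cannot lie inside the open Dikin
ellipsoid (`one_le_opNorm_sub`), so `‖v‖_y ≥ 1 - ρ`. As `b` is close to `μ ∇f(y) = μ M v`, the
objective grows along `v` at a definite rate, and a step well beyond 1 would exceed the optimal
value (`step_sub_one_le`). The last bound is the triangle inequality with `‖v‖_y ≤ √ν`. -/

namespace ConicIPM

/-! ### Norms and dual norms of positive definite operators -/

section PosDef

variable {V W : Type*} [NormedAddCommGroup V] [NormedSpace ℝ V]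
  [NormedAddCommGroup W] [NormedSpace ℝ W]

/-- `B` is symmetric and positive definite. -/
structure IsPosDef (B : V →L[ℝ] StrongDual ℝ V) : Prop where
  symm : ∀ h k, B h k = B k h
  pos : ∀ h, h ≠ 0 → 0 < B h h

theorem sq_apply_le_of_nonneg {B : V →L[ℝ] StrongDual ℝ V} (hs : ∀ h k, B h k = B k h)
    (hn : ∀ h, 0 ≤ B h h) (h k : V) : (B h k) ^ 2 ≤ B h h * B k k := by
  have hd : discrim (B k k) (2 * B h k) (B h h) ≤ 0 := by
    refine discrim_le_zero fun t => ?_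
    have := hn (h + t • k)
    simp only [map_add, map_smul, add_apply, smul_apply,
      smul_eq_mul, hs k h] at this
    linarith
  unfold discrim at hd
  linarith

theorem abs_apply_le_of_nonneg {B : V →L[ℝ] StrongDual ℝ V} (hs : ∀ h k, B h k = B k h)
    (hn : ∀ h, 0 ≤ B h h) (h k : V) : |B h k| ≤ opNorm B h * opNorm B k := by
  rw [opNorm, opNorm, ← Real.sqrt_mul (hn h)]
  exact Real.abs_le_sqrt (sq_apply_le_of_nonneg hs hn h k)

theorem opNorm_nonneg (B : V →L[ℝ] StrongDual ℝ V) (h : V) : 0 ≤ opNorm B h :=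
  Real.sqrt_nonneg _

theorem opDualNorm_nonneg (B : V →L[ℝ] StrongDual ℝ V) (g : StrongDual ℝ V) :
    0 ≤ opDualNorm B g :=
  Real.sqrt_nonneg _

theorem opNorm_congruence (B : V →L[ℝ] StrongDual ℝ V) (A : V →L[ℝ] StrongDual ℝ W) (h : W) :
    opNorm (A ∘L B.inverse ∘L A.flip) h = opDualNorm B (A.flip h) := rfl

namespace IsPosDef

variable {B : V →L[ℝ] StrongDual ℝ V}

theorem nonneg (hB : IsPosDef B) (h : V) : 0 ≤ B h h := by
  rcases eq_or_ne h 0 with rfl | hh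
  · simp
  · exact (hB.pos h hh).le

theorem sq_opNorm (hB : IsPosDef B) (h : V) : opNorm B h ^ 2 = B h h :=
  Real.sq_sqrt (hB.nonneg h)

theorem abs_apply_le (hB : IsPosDef B) (h k : V) : |B h k| ≤ opNorm B h * opNorm B k :=
  abs_apply_le_of_nonneg hB.symm hB.nonneg h k

theorem opNorm_pos (hB : IsPosDef B) {h : V} (hh : h ≠ 0) : 0 < opNorm B h :=
  Real.sqrt_pos.2 (hB.pos h hh)

theorem eq_zero_of_opNorm_le (hB : IsPosDef B) {h : V} (hh : opNorm B h ≤ 0) : h = 0 := by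
  by_contra h0
  exact absurd (hB.opNorm_pos h0) (not_lt.2 hh)

theorem opNorm_add_le (hB : IsPosDef B) (h k : V) :
    opNorm B (h + k) ≤ opNorm B h + opNorm B k := by
  refine Real.sqrt_le_iff.2 ⟨add_nonneg (opNorm_nonneg B h) (opNorm_nonneg B k), ?_⟩
  have h1 := (abs_le.1 (hB.abs_apply_le h k)).2
  have h2 := hB.sq_opNorm h
  have h3 := hB.sq_opNorm k
  simp only [map_add, add_apply, hB.symm k h]
  nlinarith

end IsPosDef

theorem opNorm_smul (B : V →L[ℝ] StrongDual ℝ V) (t : ℝ) (h : V) :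
    opNorm B (t • h) = |t| * opNorm B h := by
  have : B (t • h) (t • h) = t ^ 2 * B h h := by
    simp only [map_smul, smul_apply, smul_eq_mul]; ring
  rw [opNorm, this, Real.sqrt_mul (sq_nonneg t), Real.sqrt_sq_eq_abs, opNorm]

theorem opNorm_neg (B : V →L[ℝ] StrongDual ℝ V) (h : V) : opNorm B (-h) = opNorm B h := by
  simp [opNorm]

theorem opDualNorm_smul (B : V →L[ℝ] StrongDual ℝ V) (t : ℝ) (g : StrongDual ℝ V) :
    opDualNorm B (t • g) = |t| * opDualNorm B g := by
  have : (t • g) (B.inverse (t • g)) = t ^ 2 * g (B.inverse g) := by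
    simp only [map_smul, smul_apply, smul_eq_mul]; ring
  rw [opDualNorm, this, Real.sqrt_mul (sq_nonneg t), Real.sqrt_sq_eq_abs, opDualNorm]

theorem opDualNorm_neg (B : V →L[ℝ] StrongDual ℝ V) (g : StrongDual ℝ V) :
    opDualNorm B (-g) = opDualNorm B g := by
  simp [opDualNorm]

namespace IsPosDef

variable [FiniteDimensional ℝ V] {B : V →L[ℝ] StrongDual ℝ V}

theorem isInvertible (hB : IsPosDef B) : B.IsInvertible := by
  have hinj : Function.Injective (B : V →ₗ[ℝ] StrongDual ℝ V) := by
    rw [injective_iff_map_eq_zero]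
    intro h h0
    by_contra hne
    have h1 := hB.pos h hne
    have h2 : B h = 0 := h0
    simp [h2] at h1
  have hfr : Module.finrank ℝ V = Module.finrank ℝ (StrongDual ℝ V) := by
    rw [← Subspace.dual_finrank_eq]
    exact (LinearMap.toContinuousLinearMap (𝕜 := ℝ) (E := V) (F' := ℝ)).finrank_eq
  let e := (LinearEquiv.ofInjectiveOfFinrankEq (B : V →ₗ[ℝ] StrongDual ℝ V) hinj
    hfr).toContinuousLinearEquiv
  exact ⟨e, by ext; rfl⟩

theorem apply_inverse (hB : IsPosDef B) (g : StrongDual ℝ V) : B (B.inverse g) = g :=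
  hB.isInvertible.self_apply_inverse g

theorem inverse_apply (hB : IsPosDef B) (h : V) : B.inverse (B h) = h :=
  hB.isInvertible.inverse_apply_self h

theorem inverse_symm (hB : IsPosDef B) (g k : StrongDual ℝ V) :
    g (B.inverse k) = k (B.inverse g) := by
  conv_lhs => rw [← hB.apply_inverse g]
  conv_rhs => rw [← hB.apply_inverse k]
  rw [hB.symm]

theorem apply_inverse_eq (hB : IsPosDef B) (g : StrongDual ℝ V) :
    g (B.inverse g) = B (B.inverse g) (B.inverse g) := by
  rw [hB.apply_inverse]

theorem opNorm_inverse (hB : IsPosDef B) (g : StrongDual ℝ V) :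
    opNorm B (B.inverse g) = opDualNorm B g := by
  rw [opNorm, opDualNorm, hB.apply_inverse]

theorem opDualNorm_apply (hB : IsPosDef B) (h : V) : opDualNorm B (B h) = opNorm B h := by
  rw [opNorm, opDualNorm, hB.inverse_apply]

theorem sq_opDualNorm (hB : IsPosDef B) (g : StrongDual ℝ V) :
    opDualNorm B g ^ 2 = g (B.inverse g) := by
  rw [← hB.opNorm_inverse, hB.sq_opNorm, hB.apply_inverse]

theorem inverse_pos (hB : IsPosDef B) {g : StrongDual ℝ V} (hg : g ≠ 0) :
    0 < g (B.inverse g) := by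
  rw [hB.apply_inverse_eq]
  refine hB.pos _ fun h => hg ?_
  rw [← hB.apply_inverse g, h, map_zero]

theorem inverse_nonneg (hB : IsPosDef B) (g : StrongDual ℝ V) : 0 ≤ g (B.inverse g) := by
  rw [hB.apply_inverse_eq]
  exact hB.nonneg _

theorem abs_dual_apply_le (hB : IsPosDef B) (g : StrongDual ℝ V) (h : V) :
    |g h| ≤ opDualNorm B g * opNorm B h := by
  have := hB.abs_apply_le (B.inverse g) h
  rwa [hB.apply_inverse, hB.opNorm_inverse] at this

theorem opDualNorm_add_le (hB : IsPosDef B) (g k : StrongDual ℝ V) :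
    opDualNorm B (g + k) ≤ opDualNorm B g + opDualNorm B k := by
  simp only [← hB.opNorm_inverse, map_add]
  exact hB.opNorm_add_le _ _

/-- Reversal of an inequality between norms under duality. -/
theorem opDualNorm_le_of_opNorm_le {M : V →L[ℝ] StrongDual ℝ V} (hB : IsPosDef B)
    (hM : IsPosDef M) {C : ℝ} (hC : ∀ h, opNorm B h ≤ C * opNorm M h) (g : StrongDual ℝ V) :
    opDualNorm M g ≤ C * opDualNorm B g := by
  have h1 := (abs_le.1 (hB.abs_dual_apply_le g (M.inverse g))).2
  have h2 := hC (M.inverse g)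
  rw [← hM.sq_opDualNorm] at h1
  rw [hM.opNorm_inverse] at h2
  have h3 := opDualNorm_nonneg B g
  rcases (opDualNorm_nonneg M g).eq_or_lt with h0 | h0
  · rcases h3.eq_or_lt with h4 | h4
    · rw [← h0, ← h4, mul_zero]
    · have h5 : 0 ≤ C * opNorm M (B.inverse g) := (opNorm_nonneg B _).trans (hC _)
      rcases (opNorm_nonneg M (B.inverse g)).eq_or_lt with h6 | h6
      · have h7 := hM.eq_zero_of_opNorm_le h6.symm.le
        have h8 := hB.sq_opDualNorm g
        rw [h7, map_zero] at h8
        rw [pow_eq_zero_iff two_ne_zero] at h8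
        rw [h8, ← h0, mul_zero]
      · have h7 : 0 ≤ C := nonneg_of_mul_nonneg_left h5 h6
        rw [← h0]
        positivity
  · have h4 : opDualNorm M g * opDualNorm M g ≤ opDualNorm M g * (C * opDualNorm B g) := by
      nlinarith
    exact le_of_mul_le_mul_left h4 h0

/-- The operator `A B⁻¹ A*` is positive definite for injective `A*`. -/
theorem congruence (hB : IsPosDef B) (A : V →L[ℝ] StrongDual ℝ W)
    (hA : Function.Injective A.flip) : IsPosDef (A ∘L B.inverse ∘L A.flip) where
  symm h k := hB.inverse_symm (A.flip k) (A.flip h)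
  pos h hh := hB.inverse_pos (g := A.flip h) fun h0 => hh (hA (h0.trans (map_zero _).symm))

/-- Cauchy-Schwarz for `w` against the functional `A* G⁻¹ A w`, whose dual `B`-norm equals the dual
`G`-norm of `A w`; their pairing is the square of that norm. -/
theorem opDualNorm_congruence_le [FiniteDimensional ℝ W] (hB : IsPosDef B) (A : V →L[ℝ] StrongDual ℝ W)
    (hA : Function.Injective A.flip) (w : V) :
    opDualNorm (A ∘L B.inverse ∘L A.flip) (A w) ≤ opNorm B w := by
  have hG := hB.congruence A hA
  set G := A ∘L B.inverse ∘L A.flip with hGdef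
  have h1 := (abs_le.1 (hB.abs_dual_apply_le (A.flip (G.inverse (A w))) w)).2
  rw [← opNorm_congruence, ← hGdef, hG.opNorm_inverse, ContinuousLinearMap.flip_apply,
    ← hG.sq_opDualNorm] at h1
  rcases (opDualNorm_nonneg G (A w)).eq_or_lt with h0 | h0
  · rw [← h0]; exact opNorm_nonneg _ _
  · rw [sq] at h1
    exact le_of_mul_le_mul_left h1 h0

/-- If the quadratic form of `D` is bounded by `ε` times that of `B⁻¹`, then so is `D` as an
operator from the dual norm to the norm. -/
theorem opNorm_apply_le_of_abs_le (hB : IsPosDef B) {D : StrongDual ℝ V →L[ℝ] V}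
    (hD : ∀ g k : StrongDual ℝ V, g (D k) = k (D g)) {ε : ℝ}
    (hε : ∀ k : StrongDual ℝ V, |k (D k)| ≤ ε * k (B.inverse k)) (z : StrongDual ℝ V) :
    opNorm B (D z) ≤ ε * opDualNorm B z := by
  rcases eq_or_ne z 0 with rfl | hz
  · simp [opNorm, opDualNorm]
  have hzp := hB.inverse_pos hz
  have hε0 : 0 ≤ ε := by
    by_contra hneg
    have := (abs_nonneg _).trans (hε z)
    nlinarith
  set q := opDualNorm B z with hq
  have hqp : 0 < q := Real.sqrt_pos.2 hzp
  have hq2 : q ^ 2 = z (B.inverse z) := hB.sq_opDualNorm z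
  set k := B (D z) with hk
  set p := opNorm B (D z) with hp
  have hp2 : p ^ 2 = k (B.inverse k) := by
    rw [hp, hB.sq_opNorm, hk, hB.inverse_apply]
  have hp2' : p ^ 2 = k (D z) := hB.sq_opNorm _
  rcases (opNorm_nonneg B (D z)).eq_or_lt with h0 | h0
  · rw [hp, ← h0]; positivity
  · change 0 < p at h0
    -- Polarization. The weights give `q • k` and `p • z` the same dual norm `p q`, so subtracting
    -- the two bounds isolates the cross term `k (D z) = p ^ 2` without loss.
    have e1 := (abs_le.1 (hε (q • k + p • z))).2
    have e2 := (abs_le.1 (hε (q • k - p • z))).1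
    have hs : z (D k) = k (D z) := hD _ _
    have hs' := hB.inverse_symm z k
    simp only [map_add, map_sub, map_smul, add_apply, sub_apply,
      smul_apply, smul_eq_mul] at e1 e2
    rw [hs, hs', ← hp2, ← hq2, ← hp2'] at e1 e2
    have h3 : (q * p ^ 3) ≤ (q * p ^ 2) * (ε * q) := by nlinarith
    have h4 : (q * p ^ 2) * p ≤ (q * p ^ 2) * (ε * q) := by linarith
    exact le_of_mul_le_mul_left h4 (by positivity)

end IsPosDef

end PosDef

/-! ### Self-concordant functions of one variable -/

section OneDim

/-- The derivative of `φ ^ (-1/2)` is `-φ' / (2 φ ^ (3/2))`, of absolute value at most 1 by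
hypothesis. -/
theorem abs_inv_sqrt_sub_le {φ φ' : ℝ → ℝ} {T : ℝ} (hT : 0 ≤ T)
    (hd : ∀ t ∈ Icc 0 T, HasDerivAt φ (φ' t) t) (hpos : ∀ t ∈ Icc 0 T, 0 < φ t)
    (hb : ∀ t ∈ Icc 0 T, |φ' t| ≤ 2 * √(φ t) ^ 3) :
    |(√(φ T))⁻¹ - (√(φ 0))⁻¹| ≤ T := by
  have key := Convex.norm_image_sub_le_of_norm_hasDerivWithin_le (C := 1)
    (f := fun t => (√(φ t))⁻¹) (f' := fun t => -(φ' t / (2 * √(φ t))) / √(φ t) ^ 2)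
    (s := Icc 0 T) (x := 0) (y := T) ?_ ?_ (convex_Icc 0 T) ⟨le_rfl, hT⟩ ⟨hT, le_rfl⟩
  · simpa [abs_of_nonneg hT] using key
  · intro t ht
    exact (((hd t ht).sqrt (hpos t ht).ne').fun_inv
      (Real.sqrt_pos.2 (hpos t ht)).ne').hasDerivWithinAt
  · intro t ht
    have hs := Real.sqrt_pos.2 (hpos t ht)
    rw [Real.norm_eq_abs, abs_div, abs_neg, abs_div, abs_of_pos (by positivity : 0 < 2 * √(φ t)),
      abs_of_pos (by positivity : 0 < √(φ t) ^ 2), div_div, div_le_one (by positivity)]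
    calc |φ' t| ≤ 2 * √(φ t) ^ 3 := hb t ht
      _ = _ := by ring

theorem sqrt_le_of_selfConcordant {φ φ' : ℝ → ℝ} {T : ℝ} (hT : 0 ≤ T)
    (hd : ∀ t ∈ Icc 0 T, HasDerivAt φ (φ' t) t) (hpos : ∀ t ∈ Icc 0 T, 0 < φ t)
    (hb : ∀ t ∈ Icc 0 T, |φ' t| ≤ 2 * √(φ t) ^ 3) (hr : √(φ 0) * T < 1) :
    √(φ T) ≤ √(φ 0) / (1 - √(φ 0) * T) := by
  have h := (abs_le.1 (abs_inv_sqrt_sub_le hT hd hpos hb)).1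
  have h0 := Real.sqrt_pos.2 (hpos 0 ⟨le_rfl, hT⟩)
  have h1 := Real.sqrt_pos.2 (hpos T ⟨hT, le_rfl⟩)
  rw [le_div_iff₀ (by linarith)]
  have h2 : √(φ T) * √(φ 0) * ((√(φ T))⁻¹ - (√(φ 0))⁻¹) = √(φ 0) - √(φ T) := by
    field_simp
  nlinarith [mul_pos h1 h0]

theorem le_sqrt_of_selfConcordant {φ φ' : ℝ → ℝ} {T : ℝ} (hT : 0 ≤ T)
    (hd : ∀ t ∈ Icc 0 T, HasDerivAt φ (φ' t) t) (hpos : ∀ t ∈ Icc 0 T, 0 < φ t)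
    (hb : ∀ t ∈ Icc 0 T, |φ' t| ≤ 2 * √(φ t) ^ 3) :
    √(φ 0) / (1 + √(φ 0) * T) ≤ √(φ T) := by
  have h := (abs_le.1 (abs_inv_sqrt_sub_le hT hd hpos hb)).2
  have h0 := Real.sqrt_pos.2 (hpos 0 ⟨le_rfl, hT⟩)
  have h1 := Real.sqrt_pos.2 (hpos T ⟨hT, le_rfl⟩)
  rw [div_le_iff₀ (by positivity)]
  have h2 : √(φ T) * √(φ 0) * ((√(φ T))⁻¹ - (√(φ 0))⁻¹) = √(φ 0) - √(φ T) := by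
    field_simp
  nlinarith [mul_pos h1 h0]

/-- Growth of a function whose derivative is self-concordant. -/
theorem le_sub_of_selfConcordant {ψ φ φ' : ℝ → ℝ} {T : ℝ} (hT : 0 ≤ T)
    (hψ : ∀ t ∈ Icc 0 T, HasDerivAt ψ (φ t) t)
    (hd : ∀ t ∈ Icc 0 T, HasDerivAt φ (φ' t) t) (hpos : ∀ t ∈ Icc 0 T, 0 < φ t)
    (hb : ∀ t ∈ Icc 0 T, |φ' t| ≤ 2 * √(φ t) ^ 3) :
    φ 0 * T / (1 + √(φ 0) * T) ≤ ψ T - ψ 0 := by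
  set r := √(φ 0) with hr
  have h0 : 0 < r := Real.sqrt_pos.2 (hpos 0 ⟨le_rfl, hT⟩)
  have hr2 : r ^ 2 = φ 0 := Real.sq_sqrt (hpos 0 ⟨le_rfl, hT⟩).le
  -- The subtracted term is the primitive of `(r / (1 + r t)) ^ 2`, the lower bound for `φ t`.
  have hmono : MonotoneOn (fun t => ψ t - r ^ 2 * t / (1 + r * t)) (Icc 0 T) := by
    have hder : ∀ t ∈ Icc 0 T, HasDerivAt (fun t => ψ t - r ^ 2 * t / (1 + r * t))
        (φ t - (r / (1 + r * t)) ^ 2) t := by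
      intro t ht
      have hne : 1 + r * t ≠ 0 := by have := mul_nonneg h0.le ht.1; linarith
      have h1 : HasDerivAt (fun t : ℝ => r ^ 2 * t) (r ^ 2) t := by
        simpa using (hasDerivAt_id t).const_mul (r ^ 2)
      have h2 : HasDerivAt (fun t : ℝ => 1 + r * t) r t := by
        simpa using ((hasDerivAt_id t).const_mul r).const_add 1
      convert! (hψ t ht).sub (h1.div h2 hne) using 1
      field_simp
      ring
    refine monotoneOn_of_hasDerivWithinAt_nonneg (convex_Icc 0 T)
      (fun t ht => (hder t ht).continuousAt.continuousWithinAt)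
      (fun t ht => (hder t (interior_subset ht)).hasDerivWithinAt) fun t ht => ?_
    have ht := interior_subset ht
    have hsub : Icc 0 t ⊆ Icc 0 T := Icc_subset_Icc_right ht.2
    have := le_sqrt_of_selfConcordant ht.1 (fun s hs => hd s (hsub hs))
      (fun s hs => hpos s (hsub hs)) (fun s hs => hb s (hsub hs))
    rw [← hr] at this
    have h3 : 0 ≤ r / (1 + r * t) := by have := ht.1; positivity
    have h4 := pow_le_pow_left₀ h3 this 2
    rw [Real.sq_sqrt (hpos t ht).le] at h4
    linarith
  have := hmono ⟨le_rfl, hT⟩ ⟨hT, le_rfl⟩ hT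
  simp only [mul_zero, zero_div, sub_zero] at this
  rw [← hr2]
  linarith

theorem le_of_forall_mul_le {a b : ℝ} (h : ∀ c : ℝ, 0 < c → c < 1 → c * a ≤ b) : a ≤ b := by
  have hlim : Tendsto (fun c : ℝ => c * a) (𝓝[<] 1) (𝓝 a) := by
    have : Tendsto (fun c : ℝ => c * a) (𝓝 1) (𝓝 (1 * a)) :=
      (by fun_prop : Continuous fun c : ℝ => c * a).tendsto 1
    rw [one_mul] at this
    exact this.mono_left nhdsWithin_le_nhds
  refine le_of_tendsto hlim ?_
  filter_upwards [Ioo_mem_nhdsLT (zero_lt_one (α := ℝ))] with c hc using h c hc.1 hc.2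

end OneDim

/-! ### Polarization of the third derivative -/

section Trilinear

variable {V : Type*} [NormedAddCommGroup V] [NormedSpace ℝ V]

/-- A cubic bound for a symmetric trilinear form on the diagonal extends off the diagonal. -/
theorem IsPosDef.abs_trilinear_le {B : V →L[ℝ] StrongDual ℝ V} (hB : IsPosDef B)
    {T : V →L[ℝ] V →L[ℝ] StrongDual ℝ V} (h12 : ∀ a b c, T a b c = T b a c)
    (h23 : ∀ a b c, T a b c = T a c b) (hT : ∀ h, |T h h h| ≤ 2 * opNorm B h ^ 3) (u k : V) :
    |T u k k| ≤ 3 * opNorm B u * opNorm B k ^ 2 := by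
  rcases eq_or_ne u 0 with rfl | hu
  · simp [opNorm]
  rcases eq_or_ne k 0 with rfl | hk
  · simp [opNorm]
  have hp := hB.opNorm_pos hk
  have hq := hB.opNorm_pos hu
  have hp2 := hB.sq_opNorm k
  have hq2 := hB.sq_opNorm u
  have hu3 := abs_le.1 (hT u)
  set p := opNorm B k with hpdef
  set q := opNorm B u with hqdef
  -- The difference of the cubic values at `2q k ± p u` is `24 q² p T(u,k,k) + 2 p³ T(u,u,u)`. Both
  -- norms `m`, `n` are at most `3 p q` and `m² + n² = 10 (p q)²`, so `m³ + n³ ≤ 30 (p q)³`. This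
  -- yields the constant `64 / 24 ≤ 3`; the sharp constant 2 is not needed.
  have ha3 := abs_le.1 (hT ((2 * q) • k + p • u))
  have hb3 := abs_le.1 (hT ((2 * q) • k - p • u))
  have ha2 := hB.sq_opNorm ((2 * q) • k + p • u)
  have hb2 := hB.sq_opNorm ((2 * q) • k - p • u)
  have ha0 := opNorm_nonneg B ((2 * q) • k + p • u)
  have hb0 := opNorm_nonneg B ((2 * q) • k - p • u)
  have hb1 : opNorm B ((2 * q) • k - p • u) ≤ 3 * (p * q) := by
    rw [sub_eq_add_neg]
    refine (hB.opNorm_add_le _ _).trans_eq ?_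
    rw [opNorm_neg, opNorm_smul, opNorm_smul, abs_of_pos hp, abs_of_pos (by positivity)]
    ring
  have ha1 : opNorm B ((2 * q) • k + p • u) ≤ 3 * (p * q) := by
    refine (hB.opNorm_add_le _ _).trans_eq ?_
    rw [opNorm_smul, opNorm_smul, abs_of_pos hp, abs_of_pos (by positivity)]
    ring
  set m := opNorm B ((2 * q) • k + p • u)
  set n := opNorm B ((2 * q) • k - p • u)
  simp only [map_add, map_sub, map_smul, add_apply, sub_apply, smul_apply, smul_eq_mul,
    hB.symm u k] at ha2 hb2
  rw [← hp2, ← hq2] at ha2 hb2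
  have e1 : T k k u = T u k k := by rw [h23, h12]
  have e2 : T k u k = T u k k := h12 _ _ _
  have e3 : T u u k = T k u u := by rw [h23, h12]
  have e4 : T u k u = T k u u := h12 _ _ _
  simp only [map_add, map_sub, map_smul, add_apply, sub_apply, smul_apply, smul_eq_mul,
    e1, e2, e3, e4] at ha3 hb3
  have hmn : m ^ 2 + n ^ 2 = 10 * (p * q) ^ 2 := by linear_combination ha2 + hb2
  have hm3 : m ^ 3 ≤ 3 * (p * q) * m ^ 2 := by
    rw [pow_succ' m 2]; exact mul_le_mul_of_nonneg_right ha1 (sq_nonneg m)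
  have hn3 : n ^ 3 ≤ 3 * (p * q) * n ^ 2 := by
    rw [pow_succ' n 2]; exact mul_le_mul_of_nonneg_right hb1 (sq_nonneg n)
  have hs : m ^ 3 + n ^ 3 ≤ 30 * (p * q) ^ 3 := by
    calc m ^ 3 + n ^ 3 ≤ 3 * (p * q) * (m ^ 2 + n ^ 2) := by linarith
      _ = 30 * (p * q) ^ 3 := by rw [hmn]; ring
  have hp3 : 0 ≤ p ^ 3 := by positivity
  have hc : 0 < 24 * (q ^ 2 * p) := by positivity
  have hpq : 0 ≤ (p * q) ^ 3 := by positivity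
  rw [abs_le]
  constructor
  · refine le_of_mul_le_mul_left ?_ hc
    nlinarith [mul_le_mul_of_nonneg_left hu3.1 hp3, mul_le_mul_of_nonneg_left hu3.2 hp3]
  · refine le_of_mul_le_mul_left ?_ hc
    nlinarith [mul_le_mul_of_nonneg_left hu3.1 hp3, mul_le_mul_of_nonneg_left hu3.2 hp3]

end Trilinear

/-! ### Normal barriers on a regular cone -/

section Barrier

variable {E : Type*} [NormedAddCommGroup E] [NormedSpace ℝ E] {K : Set E} {ν : ℝ} {F : E → ℝ}

namespace IsRegularCone

theorem add_mem (hK : IsRegularCone K) {x v : E} (hx : x ∈ K) (hv : v ∈ K) : x + v ∈ K := by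
  have h := hK.smul_mem 2 (by norm_num) _
    (hK.convex hx hv (by norm_num : (0 : ℝ) ≤ 1 / 2) (by norm_num : (0 : ℝ) ≤ 1 / 2) (by norm_num))
  rwa [smul_add, smul_smul, smul_smul, show (2 : ℝ) * (1 / 2) = 1 by norm_num, one_smul,
    one_smul] at h

theorem add_mem_interior (hK : IsRegularCone K) {x v : E} (hx : x ∈ interior K) (hv : v ∈ K) :
    x + v ∈ interior K := by
  refine interior_maximal (s := K) (t := (fun z => z + v) '' interior K) ?_ ?_ ⟨x, hx, rfl⟩
  · rintro _ ⟨z, hz, rfl⟩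
    exact hK.add_mem (interior_subset hz) hv
  · exact (Homeomorph.addRight v).isOpenMap _ isOpen_interior

theorem smul_mem_interior (hK : IsRegularCone K) {x : E} (hx : x ∈ interior K) {t : ℝ}
    (ht : 0 < t) : t • x ∈ interior K := by
  refine interior_maximal (s := K) (t := (fun z => t • z) '' interior K) ?_ ?_ ⟨x, hx, rfl⟩
  · rintro _ ⟨z, hz, rfl⟩
    exact hK.smul_mem t ht.le z (interior_subset hz)
  · exact isOpenMap_smul₀ ht.ne' _ isOpen_interior

/-- A regular cone contains no line. -/
theorem eq_zero_of_line (hK : IsRegularCone K) {x h : E} (hl : ∀ t : ℝ, x + t • h ∈ K) :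
    h = 0 := by
  have key : ∀ h : E, (∀ t : ℝ, x + t • h ∈ K) → h ∈ K := by
    intro h hl
    have hlim : Tendsto (fun t : ℝ => t⁻¹ • x + h) atTop (𝓝 h) := by
      simpa using ((tendsto_inv_atTop_zero (𝕜 := ℝ)).smul_const x).add_const h
    refine hK.isClosed.mem_of_tendsto hlim ?_
    filter_upwards [eventually_gt_atTop 0] with t ht
    have := hK.smul_mem t⁻¹ (inv_nonneg.2 ht.le) _ (hl t)
    rwa [smul_add, smul_smul, inv_mul_cancel₀ ht.ne', one_smul] at this
  refine hK.pointed h (key h hl) (key (-h) fun t => ?_)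
  have := hl (-t)
  rwa [neg_smul, ← smul_neg] at this

end IsRegularCone

theorem hasDerivAt_add_smul (x h : E) (t : ℝ) : HasDerivAt (fun s : ℝ => x + s • h) h t := by
  simpa using ((hasDerivAt_id t).smul_const h).const_add x

namespace IsNormalBarrier

theorem contDiffAt (hF : IsNormalBarrier K ν F) {x : E} (hx : x ∈ interior K) :
    ContDiffAt ℝ 3 F x :=
  hF.contDiffOn.contDiffAt (isOpen_interior.mem_nhds hx)

theorem hasFDerivAt (hF : IsNormalBarrier K ν F) {x : E} (hx : x ∈ interior K) :
    HasFDerivAt F (fderiv ℝ F x) x :=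
  ((hF.contDiffAt hx).differentiableAt (by norm_num)).hasFDerivAt

theorem contDiffAt_fderiv (hF : IsNormalBarrier K ν F) {x : E} (hx : x ∈ interior K) :
    ContDiffAt ℝ 2 (fderiv ℝ F) x :=
  (hF.contDiffAt hx).fderiv_right (by norm_num)

theorem hasFDerivAt_fderiv (hF : IsNormalBarrier K ν F) {x : E} (hx : x ∈ interior K) :
    HasFDerivAt (fderiv ℝ F) (hess F x) x :=
  ((hF.contDiffAt_fderiv hx).differentiableAt (by norm_num)).hasFDerivAt

theorem contDiffAt_hess (hF : IsNormalBarrier K ν F) {x : E} (hx : x ∈ interior K) :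
    ContDiffAt ℝ 1 (hess F) x :=
  (hF.contDiffAt_fderiv hx).fderiv_right (by norm_num)

theorem hasFDerivAt_hess (hF : IsNormalBarrier K ν F) {x : E} (hx : x ∈ interior K) :
    HasFDerivAt (hess F) (fderiv ℝ (hess F) x) x :=
  ((hF.contDiffAt_hess hx).differentiableAt (by norm_num)).hasFDerivAt

theorem hess_symm (hF : IsNormalBarrier K ν F) {x : E} (hx : x ∈ interior K) (h k : E) :
    hess F x h k = hess F x k h :=
  second_derivative_symmetric_of_eventually (𝕜 := ℝ) (f := F) (f' := fderiv ℝ F)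
    (by filter_upwards [isOpen_interior.mem_nhds hx] with z hz using hF.hasFDerivAt hz)
    (hF.hasFDerivAt_fderiv hx) h k

theorem third_symm (hF : IsNormalBarrier K ν F) {x : E} (hx : x ∈ interior K) (a b c : E) :
    fderiv ℝ (hess F) x a b c = fderiv ℝ (hess F) x b a c :=
  congrArg (fun L => L c) <| second_derivative_symmetric_of_eventually (𝕜 := ℝ) (f := fderiv ℝ F)
    (f' := hess F)
    (by filter_upwards [isOpen_interior.mem_nhds hx] with z hz using hF.hasFDerivAt_fderiv hz)
    (hF.hasFDerivAt_hess hx) a b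

theorem hasDerivAt_line (hF : IsNormalBarrier K ν F) {x h : E} {t : ℝ}
    (ht : x + t • h ∈ interior K) :
    HasDerivAt (fun s : ℝ => F (x + s • h)) (fderiv ℝ F (x + t • h) h) t :=
  (hF.hasFDerivAt ht).comp_hasDerivAt t (hasDerivAt_add_smul x h t)

theorem hasDerivAt_fderiv_line (hF : IsNormalBarrier K ν F) {x h : E} {t : ℝ}
    (ht : x + t • h ∈ interior K) (k : E) :
    HasDerivAt (fun s : ℝ => fderiv ℝ F (x + s • h) k) (hess F (x + t • h) h k) t :=
  (ContinuousLinearMap.apply ℝ ℝ k).hasFDerivAt.comp_hasDerivAt t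
    ((hF.hasFDerivAt_fderiv ht).comp_hasDerivAt t (hasDerivAt_add_smul x h t))

theorem hasDerivAt_hess_line (hF : IsNormalBarrier K ν F) {x h : E} {t : ℝ}
    (ht : x + t • h ∈ interior K) (k l : E) :
    HasDerivAt (fun s : ℝ => hess F (x + s • h) k l)
      (fderiv ℝ (hess F) (x + t • h) h k l) t := by
  have h1 : HasDerivAt (fun s : ℝ => hess F (x + s • h)) (fderiv ℝ (hess F) (x + t • h) h) t :=
    HasFDerivAt.comp_hasDerivAt (l := hess F) t
      (hF.hasFDerivAt_hess ht) (hasDerivAt_add_smul x h t)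
  simpa using (h1.clm_apply (hasDerivAt_const t k)).clm_apply (hasDerivAt_const t l)

theorem third_symm' (hF : IsNormalBarrier K ν F) {x : E} (hx : x ∈ interior K) (a b c : E) :
    fderiv ℝ (hess F) x a b c = fderiv ℝ (hess F) x a c b := by
  have hx' : x + (0 : ℝ) • a ∈ interior K := by simpa using hx
  have h2 : (fun s : ℝ => hess F (x + s • a) b c) =ᶠ[𝓝 0] fun s => hess F (x + s • a) c b := by
    have hc : Tendsto (fun s : ℝ => x + s • a) (𝓝 0) (𝓝 (x + (0 : ℝ) • a)) :=
      (hasDerivAt_add_smul x a 0).continuousAt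
    filter_upwards [hc (isOpen_interior.mem_nhds hx')] with s hs using hF.hess_symm hs b c
  have h3 := (hF.hasDerivAt_hess_line hx' b c).unique
    ((hF.hasDerivAt_hess_line hx' c b).congr_of_eventuallyEq h2)
  simpa using h3

/-- The gradient inequality of a convex function. -/
theorem add_fderiv_le (hF : IsNormalBarrier K ν F) {x z : E} (hx : x ∈ interior K)
    (hz : z ∈ interior K) : F x + fderiv ℝ F x (z - x) ≤ F z := by
  have hc : ConvexOn ℝ ((AffineMap.lineMap (k := ℝ) x z) ⁻¹' interior K)
      (F ∘ AffineMap.lineMap (k := ℝ) x z) := hF.convexOn.comp_affineMap _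
  have hx' : x + (0 : ℝ) • (z - x) ∈ interior K := by simpa using hx
  have hd : HasDerivAt (F ∘ AffineMap.lineMap (k := ℝ) x z) (fderiv ℝ F x (z - x)) 0 := by
    have := hF.hasDerivAt_line hx'
    simp only [zero_smul, add_zero] at this
    refine this.congr_of_eventuallyEq (Eventually.of_forall fun s => ?_)
    simp [AffineMap.lineMap_apply, add_comm]
  have := hc.le_slope_of_hasDerivAt (x := 0) (y := 1) (by simpa using hx) (by simpa using hz)
    one_pos hd
  simp [slope] at this
  rw [map_sub]
  linarith

theorem hess_nonneg (hF : IsNormalBarrier K ν F) {x : E} (hx : x ∈ interior K) (h : E) :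
    0 ≤ hess F x h h := by
  have hx' : x + (0 : ℝ) • h ∈ interior K := by simpa using hx
  have hd := hF.hasDerivAt_fderiv_line hx' h
  rw [hasDerivAt_iff_tendsto_slope] at hd
  simp only [zero_smul, add_zero] at hd
  refine ge_of_tendsto hd ?_
  have hc : Tendsto (fun s : ℝ => x + s • h) (𝓝 0) (𝓝 (x + (0 : ℝ) • h)) :=
    (hasDerivAt_add_smul x h 0).continuousAt
  filter_upwards [self_mem_nhdsWithin, mem_nhdsWithin_of_mem_nhds
    (hc (isOpen_interior.mem_nhds hx'))] with s (hs0 : s ≠ 0) (hs : x + s • h ∈ interior K)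
  have h1 := hF.add_fderiv_le hx hs
  have h2 := hF.add_fderiv_le hs hx
  simp only [add_sub_cancel_left, sub_add_cancel_left, map_neg, map_smul, smul_eq_mul] at h1 h2
  simp only [slope, vsub_eq_sub, sub_zero, smul_eq_mul, zero_smul, add_zero]
  have h3 : 0 ≤ s⁻¹ ^ 2 * (s * (fderiv ℝ F (x + s • h) h - fderiv ℝ F x h)) := by
    have : 0 ≤ s * (fderiv ℝ F (x + s • h) h - fderiv ℝ F x h) := by linarith
    positivity
  have h4 : s⁻¹ ^ 2 * (s * (fderiv ℝ F (x + s • h) h - fderiv ℝ F x h)) =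
      s⁻¹ * (fderiv ℝ F (x + s • h) h - fderiv ℝ F x h) := by field_simp
  rwa [h4] at h3

theorem abs_third_le (hF : IsNormalBarrier K ν F) {x : E} (hx : x ∈ interior K) (h : E) :
    |fderiv ℝ (hess F) x h h h| ≤ 2 * √(hess F x h h) ^ 3 := by
  have h1 := hF.selfConcordant x hx h
  have h2 := hF.hess_nonneg hx h
  rwa [show (3 / 2 : ℝ) = (1 / 2 : ℝ) * (3 : ℕ) by norm_num, Real.rpow_mul h2, Real.rpow_natCast,
    ← Real.sqrt_eq_rpow] at h1

/-- The open Dikin ellipsoid lies in the interior of the cone. -/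
theorem add_mem_interior_of_hess_lt_one (hF : IsNormalBarrier K ν F)
    {x h : E} (hx : x ∈ interior K) (hh : hess F x h h < 1) : x + h ∈ interior K := by
  by_contra hcon
  have hlc : Continuous fun s : ℝ => x + s • h := by fun_prop
  -- `T = sInf S` is the first exit time from the interior. On `[0, T)` the second derivative along
  -- `h`, then the first, then `F` itself stay bounded, against the blow-up of `F` at the frontier.
  set S := {t : ℝ | 0 ≤ t ∧ x + t • h ∉ interior K} with hS
  have hSc : IsClosed S :=
    isClosed_Ici.inter (isOpen_interior.isClosed_compl.preimage hlc)
  have h1S : (1 : ℝ) ∈ S := ⟨zero_le_one, by simpa using hcon⟩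
  have hSb : BddBelow S := ⟨0, fun t ht => ht.1⟩
  obtain ⟨ht0, htS⟩ : sInf S ∈ S := hSc.csInf_mem ⟨1, h1S⟩ hSb
  have ht1 : sInf S ≤ 1 := csInf_le hSb h1S
  set T := sInf S with hT
  have hin : ∀ t, 0 ≤ t → t < T → x + t • h ∈ interior K := fun t h0 h1 => by
    by_contra hc
    exact absurd (csInf_le hSb ⟨h0, hc⟩) (not_le.2 h1)
  have hTpos : 0 < T := by
    rcases ht0.eq_or_lt with h0 | h0
    · rw [← h0] at htS
      exact absurd (by simpa using hx) htS
    · exact h0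
  -- The Hessian is so far only known to be semidefinite, and the one-dimensional lemma needs a
  -- positive function. Adding `ε` preserves the differential inequality and keeps the initial value
  -- below 1.
  set ε := (1 - hess F x h h) / 2 with hε
  have hε0 : 0 < ε := by rw [hε]; linarith
  set r := √(hess F x h h + ε) with hr
  have hr1 : r < 1 := by
    rw [hr, Real.sqrt_lt' one_pos]; rw [hε]; linarith
  have hr0 : 0 < r := Real.sqrt_pos.2 (by linarith [hF.hess_nonneg hx h])
  have hbound : ∀ t, 0 ≤ t → t < T → hess F (x + t • h) h h ≤ (r / (1 - r)) ^ 2 := by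
    intro t h0 h1
    have hIcc : ∀ s ∈ Icc 0 t, x + s • h ∈ interior K :=
      fun s hs => hin s hs.1 (hs.2.trans_lt h1)
    have hrt : r * t ≤ r := by nlinarith
    have := sqrt_le_of_selfConcordant (φ := fun s => hess F (x + s • h) h h + ε)
      (φ' := fun s => fderiv ℝ (hess F) (x + s • h) h h h) h0
      (fun s hs => (hF.hasDerivAt_hess_line (hIcc s hs) h h).add_const ε)
      (fun s hs => by linarith [hF.hess_nonneg (hIcc s hs) h])
      (fun s hs => (hF.abs_third_le (hIcc s hs) h).trans (by gcongr; linarith))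
      (by simp only [zero_smul, add_zero]; rw [← hr]; linarith)
    simp only [zero_smul, add_zero] at this
    rw [← hr] at this
    have h2 : √(hess F (x + t • h) h h + ε) ≤ r / (1 - r) := by
      refine this.trans ?_
      gcongr
    have h3 := (Real.sqrt_le_left (div_nonneg hr0.le (by linarith))).1 h2
    linarith
  set C := (r / (1 - r)) ^ 2 with hC
  have hC0 : 0 ≤ C := sq_nonneg _
  have hg' : ∀ t, 0 ≤ t → t < T → |fderiv ℝ F (x + t • h) h| ≤ |fderiv ℝ F x h| + C := by
    intro t h0 h1
    have hIcc : ∀ s ∈ Icc 0 t, x + s • h ∈ interior K :=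
      fun s hs => hin s hs.1 (hs.2.trans_lt h1)
    have := Convex.norm_image_sub_le_of_norm_hasDerivWithin_le (C := C)
      (f := fun s : ℝ => fderiv ℝ F (x + s • h) h) (f' := fun s => hess F (x + s • h) h h)
      (s := Icc 0 t) (x := 0) (y := t)
      (fun s hs => (hF.hasDerivAt_fderiv_line (hIcc s hs) h).hasDerivWithinAt)
      (fun s hs => by
        rw [Real.norm_of_nonneg (hF.hess_nonneg (hIcc s hs) h)]
        exact hbound s hs.1 (hs.2.trans_lt h1))
      (convex_Icc 0 t) ⟨le_rfl, h0⟩ ⟨h0, le_rfl⟩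
    simp only [zero_smul, add_zero, sub_zero, Real.norm_eq_abs, abs_of_nonneg h0] at this
    have h2 := abs_sub_abs_le_abs_sub (fderiv ℝ F (x + t • h) h) (fderiv ℝ F x h)
    nlinarith
  set M := |fderiv ℝ F x h| + C with hM
  have hM0 : 0 ≤ M := by positivity
  have hg : ∀ t, 0 ≤ t → t < T → F (x + t • h) ≤ F x + M := by
    intro t h0 h1
    have hIcc : ∀ s ∈ Icc 0 t, x + s • h ∈ interior K :=
      fun s hs => hin s hs.1 (hs.2.trans_lt h1)
    have := Convex.norm_image_sub_le_of_norm_hasDerivWithin_le (C := M)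
      (f := fun s : ℝ => F (x + s • h)) (f' := fun s => fderiv ℝ F (x + s • h) h)
      (s := Icc 0 t) (x := 0) (y := t)
      (fun s hs => (hF.hasDerivAt_line (hIcc s hs)).hasDerivWithinAt)
      (fun s hs => hg' s hs.1 (hs.2.trans_lt h1))
      (convex_Icc 0 t) ⟨le_rfl, h0⟩ ⟨h0, le_rfl⟩
    simp only [zero_smul, add_zero, sub_zero, Real.norm_eq_abs, abs_of_nonneg h0] at this
    have h2 := (abs_le.1 this).2
    nlinarith
  have hev : ∀ᶠ t in 𝓝[<] T, 0 ≤ t ∧ t < T := by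
    filter_upwards [Ioo_mem_nhdsLT hTpos] with t ht using ⟨ht.1.le, ht.2⟩
  have hlim : Tendsto (fun s : ℝ => x + s • h) (𝓝[<] T) (𝓝[interior K] (x + T • h)) := by
    refine tendsto_nhdsWithin_iff.2 ⟨(hlc.tendsto T).mono_left nhdsWithin_le_nhds, ?_⟩
    filter_upwards [hev] with t ht using hin t ht.1 ht.2
  have hfr : x + T • h ∈ frontier K := by
    refine ⟨?_, htS⟩
    refine closure_mono interior_subset (mem_closure_of_tendsto
      (tendsto_nhds_of_tendsto_nhdsWithin hlim) ?_)
    filter_upwards [hev] with t ht using hin t ht.1 ht.2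
  have htop := (hF.tendsto_frontier _ hfr).comp hlim
  obtain ⟨t, ht, ht'⟩ := ((htop.eventually_gt_atTop (F x + M)).and hev).exists
  exact absurd (hg t ht'.1 ht'.2) (not_le.2 ht)

/-- If `h` were a degenerate direction, every multiple of `h` would lie in the Dikin ellipsoid, and
the cone would contain a line. -/
theorem isPosDef_hess (hK : IsRegularCone K) (hF : IsNormalBarrier K ν F) {x : E}
    (hx : x ∈ interior K) : IsPosDef (hess F x) where
  symm := hF.hess_symm hx
  pos h hh := by
    refine (hF.hess_nonneg hx h).lt_of_ne fun h0 => hh ?_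
    refine hK.eq_zero_of_line (x := x) fun t => interior_subset
      (hF.add_mem_interior_of_hess_lt_one hx ?_)
    simp [← h0]

theorem abs_third_apply_le (hK : IsRegularCone K) (hF : IsNormalBarrier K ν F) {x : E}
    (hx : x ∈ interior K) (u k : E) :
    |fderiv ℝ (hess F) x u k k| ≤ 3 * opNorm (hess F x) u * opNorm (hess F x) k ^ 2 :=
  (hF.isPosDef_hess hK hx).abs_trilinear_le (hF.third_symm hx) (hF.third_symm' hx)
    (fun h => hF.abs_third_le hx h) u k

theorem fderiv_smul (hK : IsRegularCone K) (hF : IsNormalBarrier K ν F) {x : E}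
    (hx : x ∈ interior K) {τ : ℝ} (hτ : 0 < τ) : τ • fderiv ℝ F (τ • x) = fderiv ℝ F x := by
  have h1 : HasFDerivAt (fun z => F (τ • z)) (τ • fderiv ℝ F (τ • x)) x := by
    have := (hF.hasFDerivAt (hK.smul_mem_interior hx hτ)).comp x
      ((hasFDerivAt_id x).const_smul τ)
    convert! this using 1
    ext v
    simp
  have h2 : (fun z => F (τ • z)) =ᶠ[𝓝 x] fun z => F z - ν * Real.log τ := by
    filter_upwards [isOpen_interior.mem_nhds hx] with z hz using hF.logHomogeneous z hz τ hτ
  exact h1.unique (((hF.hasFDerivAt hx).sub_const _).congr_of_eventuallyEq h2)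

theorem fderiv_apply_self (hF : IsNormalBarrier K ν F) {x : E}
    (hx : x ∈ interior K) : fderiv ℝ F x x = -ν := by
  have hx' : (0 : E) + (1 : ℝ) • x ∈ interior K := by simpa using hx
  have h1 := hF.hasDerivAt_line hx'
  have h2 : (fun s : ℝ => F (0 + s • x)) =ᶠ[𝓝 1] fun s => F x - ν * Real.log s := by
    filter_upwards [lt_mem_nhds one_pos] with s hs
    rw [zero_add]
    exact hF.logHomogeneous x hx s hs
  have h3 : HasDerivAt (fun s => F x - ν * Real.log s) (-(ν * 1⁻¹)) 1 :=
    ((Real.hasDerivAt_log one_ne_zero).const_mul ν).const_sub (F x)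
  have := h1.unique (h3.congr_of_eventuallyEq h2)
  simpa using this

theorem hess_apply_self (hK : IsRegularCone K) (hF : IsNormalBarrier K ν F) {x : E}
    (hx : x ∈ interior K) : hess F x x = -fderiv ℝ F x := by
  ext k
  have hx' : (0 : E) + (1 : ℝ) • x ∈ interior K := by simpa using hx
  have h1 := hF.hasDerivAt_fderiv_line hx' k
  have h2 : (fun s : ℝ => fderiv ℝ F (0 + s • x) k) =ᶠ[𝓝 1] fun s => s⁻¹ * fderiv ℝ F x k := by
    filter_upwards [lt_mem_nhds one_pos] with s hs
    have hs : (0 : ℝ) < s := hs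
    rw [zero_add, ← hF.fderiv_smul hK hx hs]
    simp [hs.ne']
  have h3 : HasDerivAt (fun s : ℝ => s⁻¹ * fderiv ℝ F x k) (-(1 ^ 2)⁻¹ * fderiv ℝ F x k) 1 :=
    (hasDerivAt_inv one_ne_zero).mul_const _
  have := h1.unique (h3.congr_of_eventuallyEq h2)
  simpa using this

theorem sq_opNorm_self (hK : IsRegularCone K) (hF : IsNormalBarrier K ν F) {x : E}
    (hx : x ∈ interior K) : opNorm (hess F x) x ^ 2 = ν := by
  rw [(hF.isPosDef_hess hK hx).sq_opNorm, hF.hess_apply_self hK hx, neg_apply,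
    hF.fderiv_apply_self hx, neg_neg]

theorem parameter_nonneg (hK : IsRegularCone K) (hF : IsNormalBarrier K ν F) : 0 ≤ ν := by
  obtain ⟨x, hx⟩ := hK.interior_nonempty
  rw [← hF.sq_opNorm_self hK hx]
  positivity

/-- For interior `v`, the gradient inequality between `x` and `x + t v = t (v + x / t)` bounds `t
⟨∇F(x), v⟩` by `F(v + x / t) - ν log t - F(x)`, which is `o(t)`. A general `v` is the limit of the
interior points `ε x + v`. -/
theorem fderiv_apply_nonpos (hK : IsRegularCone K) (hF : IsNormalBarrier K ν F) {x v : E}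
    (hx : x ∈ interior K) (hv : v ∈ K) : fderiv ℝ F x v ≤ 0 := by
  have key : ∀ v ∈ interior K, fderiv ℝ F x v ≤ 0 := by
    intro v hv
    have hlim : Tendsto (fun t : ℝ => t⁻¹ * (F (v + t⁻¹ • x) - F x) - ν * (Real.log t / t))
        atTop (𝓝 0) := by
      have h1 : Tendsto (fun t : ℝ => v + t⁻¹ • x) atTop (𝓝 v) := by
        simpa using ((tendsto_inv_atTop_zero (𝕜 := ℝ)).smul_const x).const_add v
      have h2 := (hF.hasFDerivAt hv).continuousAt.tendsto.comp h1
      have h3 : Tendsto (fun t : ℝ => Real.log t / t) atTop (𝓝 0) :=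
        Real.isLittleO_log_id_atTop.tendsto_div_nhds_zero
      simpa using (tendsto_inv_atTop_zero.mul (h2.sub_const (F x))).sub (h3.const_mul ν)
    refine ge_of_tendsto hlim ?_
    filter_upwards [eventually_gt_atTop 0] with t ht
    have hz := hK.add_mem_interior hv (hK.smul_mem _ (inv_pos.2 ht).le x (interior_subset hx))
    have h1 := hF.logHomogeneous _ hz t ht
    have h2 := hF.add_fderiv_le hx (hK.smul_mem_interior hz ht)
    rw [h1] at h2
    have h3 : t • (v + t⁻¹ • x) - x = t • v := by
      rw [smul_add, smul_inv_smul₀ ht.ne', add_sub_cancel_right]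
    rw [h3, map_smul, smul_eq_mul] at h2
    have h4 : t⁻¹ * (F (v + t⁻¹ • x) - F x) - ν * (Real.log t / t) =
        t⁻¹ * (F (v + t⁻¹ • x) - ν * Real.log t - F x) := by
      field_simp
      ring
    rw [h4, le_inv_mul_iff₀ ht]
    linarith
  have h1 : ∀ ε : ℝ, 0 < ε → fderiv ℝ F x v ≤ 0 + ε * ν := fun ε hε => by
    have := key (ε • x + v) (hK.add_mem_interior (hK.smul_mem_interior hx hε) hv)
    rw [map_add, map_smul, hF.fderiv_apply_self hx, smul_eq_mul] at this
    linarith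
  have hlim : Tendsto (fun ε : ℝ => 0 + ε * ν) (𝓝[>] 0) (𝓝 0) := by
    have : Tendsto (fun ε : ℝ => 0 + ε * ν) (𝓝 0) (𝓝 (0 + 0 * ν)) :=
      (by fun_prop : Continuous fun ε : ℝ => 0 + ε * ν).tendsto 0
    simpa using this.mono_left nhdsWithin_le_nhds
  refine ge_of_tendsto hlim ?_
  filter_upwards [self_mem_nhdsWithin] with ε hε using h1 ε hε

/-- On the cone the local norm is dominated by the negative gradient. -/
theorem opNorm_le_neg_fderiv (hK : IsRegularCone K) (hF : IsNormalBarrier K ν F) {x v : E}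
    (hx : x ∈ interior K) (hv : v ∈ K) : opNorm (hess F x) v ≤ -fderiv ℝ F x v := by
  rcases eq_or_ne v 0 with rfl | hv0
  · simp [opNorm]
  by_contra! hlt
  have hin : ∀ t : ℝ, 0 ≤ t → x + t • v ∈ interior K :=
    fun t ht => hK.add_mem_interior hx (hK.smul_mem t ht v hv)
  have hr := (hF.isPosDef_hess hK hx).opNorm_pos hv0
  have hr2 := (hF.isPosDef_hess hK hx).sq_opNorm v
  set r := opNorm (hess F x) v with hrdef
  set δ := fderiv ℝ F x v + r with hδ
  have hδ0 : 0 < δ := by linarith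
  -- Along the ray the directional derivative must stay nonpositive. It starts at `δ - r`, and by
  -- time `δ⁻¹` it has grown by at least `r² / (δ + r) = r - r δ / (δ + r) > r - δ`, which makes it
  -- positive.
  have := le_sub_of_selfConcordant (ψ := fun s : ℝ => fderiv ℝ F (x + s • v) v)
    (φ := fun s => hess F (x + s • v) v v)
    (φ' := fun s => fderiv ℝ (hess F) (x + s • v) v v v) (inv_pos.2 hδ0).le
    (fun s hs => hF.hasDerivAt_fderiv_line (hin s hs.1) v)
    (fun s hs => hF.hasDerivAt_hess_line (hin s hs.1) v v)
    (fun s hs => (hF.isPosDef_hess hK (hin s hs.1)).pos v hv0)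
    (fun s hs => hF.abs_third_le (hin s hs.1) v)
  simp only [zero_smul, add_zero] at this
  rw [show √(hess F x v v) = r from rfl, ← hr2] at this
  have h2 := hF.fderiv_apply_nonpos hK (hin δ⁻¹ (inv_pos.2 hδ0).le) hv
  have h3 : r ^ 2 * δ⁻¹ / (1 + r * δ⁻¹) = r - r * δ / (δ + r) := by
    field_simp
    ring
  have h4 : r * δ / (δ + r) < δ := by
    rw [div_lt_iff₀ (by positivity)]
    nlinarith
  linarith

/-- Comparison of the local norms at two points of the cone. -/
theorem opNorm_le_mul_opNorm (hK : IsRegularCone K) (hF : IsNormalBarrier K ν F) {x z : E}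
    (hx : x ∈ interior K) (hz : z ∈ interior K) (w : E) :
    opNorm (hess F x) w ≤ -fderiv ℝ F x z * opNorm (hess F z) w := by
  rcases eq_or_ne w 0 with rfl | hw
  · simp [opNorm]
  have hB := hF.isPosDef_hess hK hx
  have hZ := hF.isPosDef_hess hK hz
  have hn := hZ.opNorm_pos hw
  have hn2 := hZ.sq_opNorm w
  set n := opNorm (hess F z) w
  refine le_of_forall_mul_le fun c hc0 hc1 => ?_
  -- Both points `z ± (c / n) w` are in the cone, so their local norms at `x` are bounded by the
  -- negative gradient. In the sum of the two bounds the terms in `w` cancel, and the difference of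
  -- the points is a multiple of `w`.
  have hmem : ∀ ε : ℝ, ε ^ 2 = 1 → z + (ε * (c / n)) • w ∈ K := fun ε hε => by
    refine interior_subset (hF.add_mem_interior_of_hess_lt_one hz ?_)
    simp only [map_smul, smul_apply, smul_eq_mul, ← hn2]
    have : ε * (c / n) * (ε * (c / n) * n ^ 2) = ε ^ 2 * c ^ 2 := by field_simp
    rw [this, hε]
    nlinarith
  have h1 := hF.opNorm_le_neg_fderiv hK hx (hmem 1 (by norm_num))
  have h2 := hF.opNorm_le_neg_fderiv hK hx (hmem (-1) (by norm_num))
  have h3 := hB.opNorm_add_le (z + (1 * (c / n)) • w) (-(z + (-1 * (c / n)) • w))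
  have h4 : z + (1 * (c / n)) • w + -(z + (-1 * (c / n)) • w) = (2 * (c / n)) • w := by
    module
  rw [h4, opNorm_neg, opNorm_smul, abs_of_pos (by positivity)] at h3
  simp only [map_add, map_smul, smul_eq_mul] at h1 h2
  have h5 : c / n * opNorm (hess F x) w ≤ -fderiv ℝ F x z := by linarith
  rw [div_mul_eq_mul_div, div_le_iff₀ hn] at h5
  exact h5

end IsNormalBarrier

end Barrier

/-! ### The dual cone and the derivatives of the dual barrier -/

section Duality

variable {E H : Type*} [NormedAddCommGroup E] [NormedSpace ℝ E]
  [NormedAddCommGroup H] [NormedSpace ℝ H] {K : Set E} {ν : ℝ} {F : E → ℝ}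

theorem finrank_strongDual [FiniteDimensional ℝ E] :
    Module.finrank ℝ (StrongDual ℝ E) = Module.finrank ℝ E := by
  rw [← Subspace.dual_finrank_eq (K := ℝ) (V := E)]
  exact (LinearMap.toContinuousLinearMap (𝕜 := ℝ) (E := E) (F' := ℝ)).finrank_eq.symm

theorem isInvertible_inclusionInDoubleDual [FiniteDimensional ℝ E] :
    (NormedSpace.inclusionInDoubleDual ℝ E).IsInvertible := by
  have hinj : Function.Injective
      (NormedSpace.inclusionInDoubleDual ℝ E : E →ₗ[ℝ] StrongDual ℝ (StrongDual ℝ E)) :=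
    (NormedSpace.inclusionInDoubleDualLi (𝕜 := ℝ) (E := E)).injective
  let e := (LinearEquiv.ofInjectiveOfFinrankEq _ hinj
    (by rw [finrank_strongDual, finrank_strongDual])).toContinuousLinearEquiv
  exact ⟨e, by ext; rfl⟩

theorem ofBidual_inclusionInDoubleDual [FiniteDimensional ℝ E] (x : E) :
    ofBidual (NormedSpace.inclusionInDoubleDual ℝ E x) = x :=
  isInvertible_inclusionInDoubleDual.inverse_apply_self x

/-- A functional that vanishes on the kernel of a surjective `A` is in the range of `A*`. -/
theorem exists_flip_eq_of_ker [FiniteDimensional ℝ E] [FiniteDimensional ℝ H]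
    {A : E →L[ℝ] StrongDual ℝ H} (hA : Function.Surjective A) {g : StrongDual ℝ E}
    (hg : ∀ h, A h = 0 → g h = 0) : ∃ y : H, A.flip y = g := by
  obtain ⟨R, hR⟩ := (A : E →ₗ[ℝ] StrongDual ℝ H).exists_rightInverse_of_surjective
    (LinearMap.range_eq_top.2 hA)
  obtain ⟨y, hy⟩ := (isInvertible_inclusionInDoubleDual (E := H)).surjective
    (g ∘L R.toContinuousLinearMap)
  refine ⟨y, ContinuousLinearMap.ext fun h => ?_⟩
  have hRA : ∀ u, A (R u) = u := fun u => LinearMap.congr_fun hR u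
  have h1 : g (h - R (A h)) = 0 := hg _ (by rw [map_sub, hRA, sub_self])
  have h2 : A h y = g (R (A h)) := congrArg (fun L => L (A h)) hy
  rw [map_sub, sub_eq_zero] at h1
  rw [ContinuousLinearMap.flip_apply, h2, h1]

theorem flip_injective [FiniteDimensional ℝ H]
    {A : E →L[ℝ] StrongDual ℝ H} (hA : Function.Surjective A) :
    Function.Injective A.flip := by
  rw [injective_iff_map_eq_zero]
  intro y hy
  by_contra hne
  obtain ⟨g, hg⟩ := SeparatingDual.exists_ne_zero (R := ℝ) hne
  obtain ⟨x, rfl⟩ := hA g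
  exact hg (congrArg (fun L => L x) hy)

theorem isClosed_dualCone (K : Set E) : IsClosed (dualCone K) := by
  have : dualCone K = ⋂ x ∈ K, {s : StrongDual ℝ E | 0 ≤ s x} := by
    ext s; simp [dualCone]
  rw [this]
  exact isClosed_biInter fun x _ =>
    isClosed_le continuous_const (ContinuousLinearMap.apply ℝ ℝ x).continuous

theorem convex_dualCone (K : Set E) : Convex ℝ (dualCone K) := by
  intro s hs u hu p q hp hq _ x hx
  have h1 := mul_nonneg hp (hs x hx)
  have h2 := mul_nonneg hq (hu x hx)
  simpa using add_nonneg h1 h2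

theorem smul_mem_interior_dualCone {s : StrongDual ℝ E}
    (hs : s ∈ interior (dualCone K)) {t : ℝ} (ht : 0 < t) : t • s ∈ interior (dualCone K) := by
  refine interior_maximal (s := dualCone K)
    (t := (fun z : StrongDual ℝ E => t • z) '' interior (dualCone K)) ?_ ?_ ⟨s, hs, rfl⟩
  · rintro _ ⟨z, hz, rfl⟩ x hx
    exact mul_nonneg ht.le (interior_subset hz x hx)
  · exact isOpenMap_smul₀ ht.ne' _ isOpen_interior

theorem segment_mem_interior_dualCone {s s' : StrongDual ℝ E} (hs : s ∈ interior (dualCone K))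
    (hs' : s' ∈ interior (dualCone K)) {t : ℝ} (ht : t ∈ Icc (0 : ℝ) 1) :
    s + t • (s' - s) ∈ interior (dualCone K) :=
  (convex_dualCone K).interior.add_smul_sub_mem hs hs' ht

/-- Subtracting a small multiple of a functional norming `x` keeps `s` in the dual cone. This is the
coercivity behind the existence of minimizers. -/
theorem exists_mul_norm_le_of_mem_interior_dualCone {s : StrongDual ℝ E}
    (hs : s ∈ interior (dualCone K)) : ∃ δ > 0, ∀ x ∈ K, δ * ‖x‖ ≤ s x := by
  obtain ⟨ε, hε, hball⟩ := Metric.mem_nhds_iff.1 (mem_interior_iff_mem_nhds.1 hs)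
  refine ⟨ε / 2, by positivity, fun x hx => ?_⟩
  obtain ⟨g, hg1, hgx⟩ := exists_dual_vector'' ℝ x
  have hmem : s - (ε / 2) • g ∈ Metric.ball s ε := by
    rw [Metric.mem_ball, dist_eq_norm, sub_sub_cancel_left, norm_neg, norm_smul,
      Real.norm_of_nonneg (by positivity)]
    nlinarith
  have := hball hmem x hx
  simp only [sub_apply, smul_apply, smul_eq_mul, hgx] at this
  simpa using this

namespace IsNormalBarrier

/-- The dual Dikin ellipsoid lies in the dual cone. -/
theorem mem_dualCone_of_opDualNorm_le_one [FiniteDimensional ℝ E] (hK : IsRegularCone K)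
    (hF : IsNormalBarrier K ν F) {x : E} (hx : x ∈ interior K) {s : StrongDual ℝ E}
    (hs : opDualNorm (hess F x) (s + fderiv ℝ F x) ≤ 1) : s ∈ dualCone K := by
  intro z hz
  have h1 := (abs_le.1 ((hF.isPosDef_hess hK hx).abs_dual_apply_le (s + fderiv ℝ F x) z)).1
  have h2 := hF.opNorm_le_neg_fderiv hK hx hz
  have h3 := opNorm_nonneg (hess F x) z
  rw [add_apply] at h1
  nlinarith

theorem neg_fderiv_mem_interior_dualCone [FiniteDimensional ℝ E] (hK : IsRegularCone K)
    (hF : IsNormalBarrier K ν F) {x : E} (hx : x ∈ interior K) :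
    -fderiv ℝ F x ∈ interior (dualCone K) := by
  let O : Set (StrongDual ℝ E) :=
    {s | (s + fderiv ℝ F x) ((hess F x).inverse (s + fderiv ℝ F x)) < 1}
  have hO : IsOpen O := by
    refine isOpen_lt ?_ continuous_const
    fun_prop
  refine interior_maximal (t := O) (fun s hs => ?_) hO (by simp [O])
  refine hF.mem_dualCone_of_opDualNorm_le_one hK hx ?_
  exact Real.sqrt_le_one.2 (le_of_lt hs)

/-- Minima of `⟨s, ·⟩ + F` over closed sets are attained for `s` in the interior of the dual
cone. -/
theorem exists_isMinOn [FiniteDimensional ℝ E] (hK : IsRegularCone K)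
    (hF : IsNormalBarrier K ν F) {s : StrongDual ℝ E} (hs : s ∈ interior (dualCone K))
    {C : Set E} (hC : IsClosed C) (hne : (C ∩ interior K).Nonempty) :
    ∃ x ∈ C ∩ interior K, ∀ z ∈ C ∩ interior K, s x + F x ≤ s z + F z := by
  obtain ⟨z₀, hz₀⟩ := hne
  obtain ⟨δ, hδ, hsδ⟩ := exists_mul_norm_le_of_mem_interior_dualCone hs
  set L := {z ∈ C ∩ interior K | s z + F z ≤ s z₀ + F z₀} with hL
  have hcont : ∀ z ∈ interior K, ContinuousAt (fun z => s z + F z) z := fun z hz =>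
    s.continuous.continuousAt.add (hF.hasFDerivAt hz).continuousAt
  have hbdd : Bornology.IsBounded L := by
    -- The gradient at `τ • z₀` is `τ⁻¹ ∇F(z₀)`; this `τ` makes its norm at most `δ / 2`, so the
    -- linear minorant of `F` there uses up only half of the coercivity of `s`.
    set τ := 2 * (‖fderiv ℝ F z₀‖ + 1) / δ with hτ
    have hτ0 : 0 < τ := by positivity
    set R := (s z₀ + F z₀ - F (τ • z₀) - ν) / (δ / 2) with hR
    refine (Metric.isBounded_closedBall (x := (0 : E)) (r := R)).subset fun z hz => ?_
    obtain ⟨⟨_, hzK⟩, hzle⟩ := hz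
    have h1 := hF.add_fderiv_le (hK.smul_mem_interior hz₀.2 hτ0) hzK
    have h2 : fderiv ℝ F (τ • z₀) = τ⁻¹ • fderiv ℝ F z₀ := by
      rw [← hF.fderiv_smul hK hz₀.2 hτ0, smul_smul, inv_mul_cancel₀ hτ0.ne', one_smul]
    have h3 := hF.fderiv_apply_self (hK.smul_mem_interior hz₀.2 hτ0)
    rw [map_sub, h3, h2, smul_apply, smul_eq_mul] at h1
    have h4 : -(τ⁻¹ * (fderiv ℝ F z₀ z)) ≤ δ / 2 * ‖z‖ := by
      have h5 := (fderiv ℝ F z₀).le_opNorm z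
      have h6 := neg_le_of_neg_le (neg_abs_le (fderiv ℝ F z₀ z))
      rw [Real.norm_eq_abs] at h5
      have h7 : δ / 2 = τ⁻¹ * (‖fderiv ℝ F z₀‖ + 1) := by
        rw [hτ]; field_simp
      rw [h7, ← mul_neg, mul_assoc]
      have := norm_nonneg z
      gcongr
      nlinarith [neg_abs_le (fderiv ℝ F z₀ z)]
    have h8 := hsδ z (interior_subset hzK)
    rw [mem_closedBall_zero_iff, hR, le_div_iff₀ (by positivity)]
    linarith
  have hclosed : IsClosed L := by
    refine isClosed_of_closure_subset fun z hz => ?_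
    have hzC : z ∈ C := hC.closure_subset_iff.2 (fun w hw => hw.1.1) hz
    have hzK : z ∈ K := hK.isClosed.closure_subset_iff.2 (fun w hw => interior_subset hw.1.2) hz
    have hnb : (𝓝[L] z).NeBot := mem_closure_iff_nhdsWithin_neBot.1 hz
    have hev : ∀ᶠ w in 𝓝[L] z, s w + F w ≤ s z₀ + F z₀ := by
      filter_upwards [self_mem_nhdsWithin] with w hw using hw.2
    by_cases hzi : z ∈ interior K
    · exact ⟨⟨hzC, hzi⟩, le_of_tendsto ((hcont z hzi).mono_left nhdsWithin_le_nhds) hev⟩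
    · have hfr : z ∈ frontier K := ⟨subset_closure hzK, hzi⟩
      have h1 : Tendsto F (𝓝[L] z) atTop :=
        (hF.tendsto_frontier z hfr).mono_left (nhdsWithin_mono z fun w hw => hw.1.2)
      have h2 : Tendsto s (𝓝[L] z) (𝓝 (s z)) :=
        (s.continuous.tendsto z).mono_left nhdsWithin_le_nhds
      have h3 := h2.add_atTop h1
      obtain ⟨w, hw1, hw2⟩ := ((h3.eventually_gt_atTop (s z₀ + F z₀)).and hev).exists
      exact absurd hw2 (not_le.2 hw1)
  have hcomp := Metric.isCompact_of_isClosed_isBounded hclosed hbdd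
  obtain ⟨x, hx, hmin⟩ := hcomp.exists_isMinOn (f := fun z => s z + F z) ⟨z₀, hz₀, le_rfl⟩
    fun z hz => (hcont z hz.1.2).continuousWithinAt
  refine ⟨x, hx.1, fun z hz => ?_⟩
  rcases le_total (s z + F z) (s z₀ + F z₀) with h | h
  · exact hmin (⟨hz, h⟩ : z ∈ L)
  · exact hx.2.trans h

/-- First-order optimality on an affine subspace. -/
theorem exists_forall_ker [FiniteDimensional ℝ E] (hK : IsRegularCone K)
    (hF : IsNormalBarrier K ν F) {s : StrongDual ℝ E} (hs : s ∈ interior (dualCone K))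
    {Z : Type*} [NormedAddCommGroup Z] [NormedSpace ℝ Z] (A : E →L[ℝ] Z) {z₀ : E}
    (hz₀ : z₀ ∈ interior K) :
    ∃ x ∈ interior K, A x = A z₀ ∧ ∀ h, A h = 0 → s h + fderiv ℝ F x h = 0 := by
  obtain ⟨x, ⟨hxA, hx⟩, hmin⟩ := hF.exists_isMinOn hK hs (C := {z | A z = A z₀})
    (isClosed_eq A.continuous continuous_const) ⟨z₀, rfl, hz₀⟩
  refine ⟨x, hx, hxA, fun h hh => ?_⟩
  have hx0 : x + (0 : ℝ) • h ∈ interior K := by simpa using hx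
  have hd : HasDerivAt (fun t : ℝ => s (x + t • h) + F (x + t • h))
      (s h + fderiv ℝ F (x + (0 : ℝ) • h) h) 0 :=
    (s.hasFDerivAt.comp_hasDerivAt 0 (hasDerivAt_add_smul x h 0)).add (hF.hasDerivAt_line hx0)
  have hloc : IsLocalMin (fun t : ℝ => s (x + t • h) + F (x + t • h)) 0 := by
    have hc : Tendsto (fun s : ℝ => x + s • h) (𝓝 0) (𝓝 (x + (0 : ℝ) • h)) :=
      (hasDerivAt_add_smul x h 0).continuousAt
    filter_upwards [hc (isOpen_interior.mem_nhds hx0)] with t ht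
    simp only [zero_smul, add_zero]
    refine hmin _ ⟨?_, ht⟩
    simpa [hh] using hxA
  simpa using hloc.hasDerivAt_eq_zero hd

theorem exists_neg_fderiv_eq [FiniteDimensional ℝ E] (hK : IsRegularCone K)
    (hF : IsNormalBarrier K ν F) {s : StrongDual ℝ E} (hs : s ∈ interior (dualCone K)) :
    ∃ x ∈ interior K, -fderiv ℝ F x = s := by
  obtain ⟨z₀, hz₀⟩ := hK.interior_nonempty
  obtain ⟨x, hx, -, h⟩ := hF.exists_forall_ker hK hs (0 : E →L[ℝ] ℝ) hz₀
  refine ⟨x, hx, ContinuousLinearMap.ext fun k => ?_⟩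
  rw [neg_apply]
  linarith [h k rfl]

theorem fderiv_injOn (hK : IsRegularCone K) (hF : IsNormalBarrier K ν F) :
    InjOn (fderiv ℝ F) (interior K) := by
  intro x hx z hz hxz
  by_contra hne
  have hin : ∀ t ∈ Icc (0 : ℝ) 1, x + t • (z - x) ∈ interior K := fun t ht =>
    hK.convex.interior.add_smul_sub_mem hx hz ht
  obtain ⟨t, ht, hslope⟩ := exists_hasDerivAt_eq_slope
    (fun t : ℝ => fderiv ℝ F (x + t • (z - x)) (z - x))
    (fun t => hess F (x + t • (z - x)) (z - x) (z - x)) one_pos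
    (fun t ht => (hF.hasDerivAt_fderiv_line (hin t ht) _).continuousAt.continuousWithinAt)
    (fun t ht => hF.hasDerivAt_fderiv_line (hin t (Ioo_subset_Icc_self ht)) _)
  have hpos := (hF.isPosDef_hess hK (hin t (Ioo_subset_Icc_self ht))).pos (z - x)
    (sub_ne_zero.2 (Ne.symm hne))
  simp only [hxz, one_smul, zero_smul, add_zero, add_sub_cancel, sub_self, zero_div] at hslope
  exact hpos.ne' hslope

end IsNormalBarrier

/-- The point `x` of the interior of the cone with `-∇F(x) = s`. -/
noncomputable def dualPoint (K : Set E) (F : E → ℝ) (s : StrongDual ℝ E) : E :=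
  letI : Nonempty E := ⟨0⟩
  Classical.epsilon fun x => x ∈ interior K ∧ -fderiv ℝ F x = s

namespace IsNormalBarrier

variable [FiniteDimensional ℝ E]

theorem dualPoint_spec (hK : IsRegularCone K) (hF : IsNormalBarrier K ν F)
    {s : StrongDual ℝ E} (hs : s ∈ interior (dualCone K)) :
    dualPoint K F s ∈ interior K ∧ -fderiv ℝ F (dualPoint K F s) = s := by
  obtain ⟨x, hx⟩ := hF.exists_neg_fderiv_eq hK hs
  exact Classical.epsilon_spec (p := fun x => x ∈ interior K ∧ -fderiv ℝ F x = s) ⟨x, hx⟩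

theorem dualPoint_neg_fderiv (hK : IsRegularCone K) (hF : IsNormalBarrier K ν F) {x : E}
    (hx : x ∈ interior K) : dualPoint K F (-fderiv ℝ F x) = x := by
  obtain ⟨h1, h2⟩ := hF.dualPoint_spec hK (hF.neg_fderiv_mem_interior_dualCone hK hx)
  exact hF.fderiv_injOn hK h1 hx (neg_injective h2)

/-- `dualPoint` composed with negation is a left inverse of `∇F` near `x`, and `∇F` has the
invertible strict derivative `∇²F(x)`. -/
theorem hasFDerivAt_dualPoint (hK : IsRegularCone K) (hF : IsNormalBarrier K ν F)
    {s : StrongDual ℝ E} (hs : s ∈ interior (dualCone K)) :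
    HasFDerivAt (dualPoint K F) (-(hess F (dualPoint K F s)).inverse) s := by
  obtain ⟨hx, hxs⟩ := hF.dualPoint_spec hK hs
  set x := dualPoint K F s
  obtain ⟨e, he⟩ := (hF.isPosDef_hess hK hx).isInvertible
  have h1 : HasStrictFDerivAt (fderiv ℝ F) (hess F x) x :=
    (hF.contDiffAt_fderiv hx).hasStrictFDerivAt' (hF.hasFDerivAt_fderiv hx) (by norm_num)
  have h2 : HasStrictFDerivAt (fderiv ℝ F) (e : E →L[ℝ] StrongDual ℝ E) x := by rwa [he]
  have h3 : HasStrictFDerivAt (fun u => dualPoint K F (-u))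
      (e.symm : StrongDual ℝ E →L[ℝ] E) (fderiv ℝ F x) := by
    refine h2.to_local_left_inverse ?_
    filter_upwards [isOpen_interior.mem_nhds hx] with z hz using hF.dualPoint_neg_fderiv hK hz
  have h4 : HasFDerivAt (fun u : StrongDual ℝ E => -u)
      (-ContinuousLinearMap.id ℝ (StrongDual ℝ E)) s := (hasFDerivAt_id s).neg
  have hxs' : fderiv ℝ F x = -s := by rw [← hxs, neg_neg]
  rw [hxs'] at h3
  have h5 := HasFDerivAt.comp s (g := fun u => dualPoint K F (-u)) h3.hasFDerivAt h4
  have h6 : (fun u => dualPoint K F (-u)) ∘ (fun u : StrongDual ℝ E => -u) = dualPoint K F := by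
    ext u; simp
  rw [h6] at h5
  rw [← he, ContinuousLinearMap.inverse_equiv]
  convert! h5 using 1
  ext u
  simp

theorem dualBarrier_eq (hK : IsRegularCone K) (hF : IsNormalBarrier K ν F)
    {s : StrongDual ℝ E} (hs : s ∈ interior (dualCone K)) :
    dualBarrier K F s = -(s (dualPoint K F s)) - F (dualPoint K F s) := by
  obtain ⟨hx, hxs⟩ := hF.dualPoint_spec hK hs
  refine IsGreatest.csSup_eq ⟨⟨_, hx, rfl⟩, ?_⟩
  rintro _ ⟨z, hz, rfl⟩
  have h1 := hF.add_fderiv_le hx hz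
  have h2 : fderiv ℝ F (dualPoint K F s) = -s := by rw [← neg_eq_iff_eq_neg]; exact hxs
  rw [h2, neg_apply, map_sub] at h1
  simp only
  linarith

/-- Envelope argument: the terms coming from the motion of the maximizer cancel because `∇F = -s`
there. -/
theorem hasFDerivAt_dualBarrier (hK : IsRegularCone K) (hF : IsNormalBarrier K ν F)
    {s : StrongDual ℝ E} (hs : s ∈ interior (dualCone K)) :
    HasFDerivAt (dualBarrier K F)
      (-NormedSpace.inclusionInDoubleDual ℝ E (dualPoint K F s)) s := by
  obtain ⟨hx, hxs⟩ := hF.dualPoint_spec hK hs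
  have h0 := hF.hasFDerivAt_dualPoint hK hs
  have h1 := (hasFDerivAt_id (𝕜 := ℝ) s).clm_apply h0
  have h2 := (hF.hasFDerivAt hx).comp s h0
  have h3 : (dualBarrier K F) =ᶠ[𝓝 s]
      fun s => -(s (dualPoint K F s)) - F (dualPoint K F s) := by
    filter_upwards [isOpen_interior.mem_nhds hs] with u hu using hF.dualBarrier_eq hK hu
  have h4 : fderiv ℝ F (dualPoint K F s) = -s := by rw [← neg_eq_iff_eq_neg]; exact hxs
  convert! (h1.neg.sub h2).congr_of_eventuallyEq h3 using 1
  ext u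
  simp [h4]

theorem fderiv_dualBarrier (hK : IsRegularCone K) (hF : IsNormalBarrier K ν F)
    {s : StrongDual ℝ E} (hs : s ∈ interior (dualCone K)) :
    fderiv ℝ (dualBarrier K F) s = -NormedSpace.inclusionInDoubleDual ℝ E (dualPoint K F s) :=
  (hF.hasFDerivAt_dualBarrier hK hs).fderiv

theorem ofBidual_hess_dualBarrier (hK : IsRegularCone K) (hF : IsNormalBarrier K ν F)
    {s : StrongDual ℝ E} (hs : s ∈ interior (dualCone K)) (u : StrongDual ℝ E) :
    ofBidual (hess (dualBarrier K F) s u) = (hess F (dualPoint K F s)).inverse u := by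
  have h1 : HasFDerivAt (fderiv ℝ (dualBarrier K F))
      (-(NormedSpace.inclusionInDoubleDual ℝ E ∘L (-(hess F (dualPoint K F s)).inverse))) s := by
    have h2 := (HasFDerivAt.comp (g := NormedSpace.inclusionInDoubleDual ℝ E) s
      (NormedSpace.inclusionInDoubleDual ℝ E).hasFDerivAt (hF.hasFDerivAt_dualPoint hK hs)).neg
    refine h2.congr_of_eventuallyEq ?_
    filter_upwards [isOpen_interior.mem_nhds hs] with u hu using hF.fderiv_dualBarrier hK hu
  have h3 : hess (dualBarrier K F) s u =
      NormedSpace.inclusionInDoubleDual ℝ E ((hess F (dualPoint K F s)).inverse u) := by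
    rw [hess, h1.fderiv]
    simp
  rw [h3, ofBidual_inclusionInDoubleDual]

/-- The derivative of the dual quadratic form along a segment of the dual cone. -/
theorem hasDerivAt_dual_form (hK : IsRegularCone K) (hF : IsNormalBarrier K ν F)
    {s u : StrongDual ℝ E} {t : ℝ} (ht : s + t • u ∈ interior (dualCone K))
    (k : StrongDual ℝ E) :
    HasDerivAt (fun τ : ℝ => k ((hess F (dualPoint K F (s + τ • u))).inverse k))
      (fderiv ℝ (hess F) (dualPoint K F (s + t • u))
        ((hess F (dualPoint K F (s + t • u))).inverse u)
        ((hess F (dualPoint K F (s + t • u))).inverse k)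
        ((hess F (dualPoint K F (s + t • u))).inverse k)) t := by
  obtain ⟨hx, hxs⟩ := hF.dualPoint_spec hK ht
  have hB := hF.isPosDef_hess hK hx
  have hX : HasDerivAt (fun τ : ℝ => dualPoint K F (s + τ • u))
      (-((hess F (dualPoint K F (s + t • u))).inverse u)) t :=
    HasFDerivAt.comp_hasDerivAt (l := dualPoint K F) (f := fun τ : ℝ => s + τ • u) t
      (hF.hasFDerivAt_dualPoint hK ht) (hasDerivAt_add_smul s u t)
  set x := dualPoint K F (s + t • u) with hxdef
  set T := fderiv ℝ (hess F) x with hT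
  have hH : HasDerivAt (fun τ : ℝ => hess F (dualPoint K F (s + τ • u)))
      (T (-((hess F x).inverse u))) t :=
    HasFDerivAt.comp_hasDerivAt (l := hess F) t (hF.hasFDerivAt_hess hx) hX
  obtain ⟨L, hL⟩ : ∃ L, HasFDerivAt (ContinuousLinearMap.inverse :
      (E →L[ℝ] StrongDual ℝ E) → (StrongDual ℝ E →L[ℝ] E)) L (hess F x) :=
    ⟨_, ((hB.isInvertible.contDiffAt_map_inverse (n := 1)).differentiableAt
      (by norm_num)).hasFDerivAt⟩
  have hP : HasDerivAt (fun τ : ℝ => (hess F (dualPoint K F (s + τ • u))).inverse)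
      (L (T (-((hess F x).inverse u)))) t :=
    HasFDerivAt.comp_hasDerivAt (l := (ContinuousLinearMap.inverse :
      (E →L[ℝ] StrongDual ℝ E) → (StrongDual ℝ E →L[ℝ] E)))
      (f := fun τ : ℝ => hess F (dualPoint K F (s + τ • u))) t hL hH
  have hw : HasDerivAt (fun τ : ℝ => (hess F (dualPoint K F (s + τ • u))).inverse k)
      (L (T (-((hess F x).inverse u))) k) t := by
    simpa using hP.clm_apply (hasDerivAt_const t k)
  set w' := L (T (-((hess F x).inverse u))) k with hw'
  -- Only the existence of the derivative of operator inversion is used. Its value comes from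
  -- differentiating the constant `∇²F [∇²F]⁻¹ k = k` and pairing with `[∇²F]⁻¹ k`.
  have hid := hH.clm_apply hw
  have hc : (fun τ : ℝ => hess F (dualPoint K F (s + τ • u))
      ((hess F (dualPoint K F (s + τ • u))).inverse k)) =ᶠ[𝓝 t] fun _ => k := by
    have hcont : Tendsto (fun τ : ℝ => s + τ • u) (𝓝 t) (𝓝 (s + t • u)) :=
      (hasDerivAt_add_smul s u t).continuousAt
    filter_upwards [hcont (isOpen_interior.mem_nhds ht)] with τ hτ
    exact (hF.isPosDef_hess hK (hF.dualPoint_spec hK hτ).1).apply_inverse k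
  have h0 := hid.unique ((hasDerivAt_const t k).congr_of_eventuallyEq hc)
  have h1 := congrArg (fun g => g ((hess F x).inverse k)) h0
  simp only [add_apply, map_neg, neg_apply, zero_apply, ← hxdef] at h1
  have h2 : k w' = hess F x w' ((hess F x).inverse k) := by
    rw [hB.symm, hB.apply_inverse]
  have h3 : HasDerivAt (fun τ : ℝ => k ((hess F (dualPoint K F (s + τ • u))).inverse k))
      (k w') t := k.hasFDerivAt.comp_hasDerivAt t hw
  convert! h3 using 1
  linarith

end IsNormalBarrier

end Duality

/-! ### Stability of the dual Hessian -/

section Comparison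

variable {E : Type*} [NormedAddCommGroup E] [NormedSpace ℝ E] [FiniteDimensional ℝ E]
  {K : Set E} {ν : ℝ} {F : E → ℝ}

namespace IsNormalBarrier

/-- On the dual cone the dual local norm is dominated by evaluation. -/
theorem opDualNorm_le_apply (hK : IsRegularCone K) (hF : IsNormalBarrier K ν F) {x : E}
    (hx : x ∈ interior K) {z : StrongDual ℝ E} (hz : z ∈ dualCone K) :
    opDualNorm (hess F x) z ≤ z x := by
  have hB := hF.isPosDef_hess hK hx
  refine le_of_forall_mul_le fun c hc0 hc1 => ?_
  rcases (opDualNorm_nonneg (hess F x) z).eq_or_lt with h0 | h0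
  · rw [← h0, mul_zero]
    exact hz x (interior_subset hx)
  · have h2 := hB.sq_opDualNorm z
    set n := opDualNorm (hess F x) z
    have h1 : x + (-(c / n)) • (hess F x).inverse z ∈ interior K := by
      refine hF.add_mem_interior_of_hess_lt_one hx ?_
      simp only [map_smul, smul_apply, smul_eq_mul, hB.apply_inverse, ← h2]
      have : -(c / n) * (-(c / n) * n ^ 2) = c ^ 2 := by field_simp
      rw [this]
      nlinarith
    have h3 := hz _ (interior_subset h1)
    rw [map_add, map_smul, smul_eq_mul, ← h2] at h3
    have : -(c / n) * n ^ 2 = -(c * n) := by field_simp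
    linarith

section Segment

variable {s s' : StrongDual ℝ E}

/-- The trilinear bound along a segment of the dual cone. -/
theorem abs_deriv_dual_form_le (hK : IsRegularCone K) (hF : IsNormalBarrier K ν F)
    (hs : s ∈ interior (dualCone K)) (u k : StrongDual ℝ E) :
    |fderiv ℝ (hess F) (dualPoint K F s) ((hess F (dualPoint K F s)).inverse u)
        ((hess F (dualPoint K F s)).inverse k) ((hess F (dualPoint K F s)).inverse k)| ≤
      3 * √(u ((hess F (dualPoint K F s)).inverse u)) *
        k ((hess F (dualPoint K F s)).inverse k) := by
  have hx := (hF.dualPoint_spec hK hs).1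
  have hB := hF.isPosDef_hess hK hx
  have := hF.abs_third_apply_le hK hx ((hess F (dualPoint K F s)).inverse u)
    ((hess F (dualPoint K F s)).inverse k)
  rwa [hB.opNorm_inverse, hB.opNorm_inverse, hB.sq_opDualNorm] at this

theorem abs_deriv_dual_form_self_le (hK : IsRegularCone K) (hF : IsNormalBarrier K ν F)
    (hs : s ∈ interior (dualCone K)) (u : StrongDual ℝ E) :
    |fderiv ℝ (hess F) (dualPoint K F s) ((hess F (dualPoint K F s)).inverse u)
        ((hess F (dualPoint K F s)).inverse u) ((hess F (dualPoint K F s)).inverse u)| ≤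
      2 * √(u ((hess F (dualPoint K F s)).inverse u)) ^ 3 := by
  have hx := (hF.dualPoint_spec hK hs).1
  have hB := hF.isPosDef_hess hK hx
  have := hF.abs_third_le hx ((hess F (dualPoint K F s)).inverse u)
  rwa [← hB.apply_inverse_eq] at this

/-- Strong monotonicity of the gradient of the dual barrier. -/
theorem div_le_apply_dualPoint_sub (hK : IsRegularCone K) (hF : IsNormalBarrier K ν F)
    (hs : s ∈ interior (dualCone K)) (hs' : s' ∈ interior (dualCone K)) {r : ℝ}
    (hr : r = opDualNorm (hess F (dualPoint K F s)) (s' - s)) :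
    r ^ 2 / (1 + r) ≤ (s' - s) (dualPoint K F s) - (s' - s) (dualPoint K F s') := by
  rcases eq_or_ne (s' - s) 0 with h0 | h0
  · simp [hr, h0, opDualNorm]
  set u := s' - s with hu
  have hin := fun t (ht : t ∈ Icc (0 : ℝ) 1) => segment_mem_interior_dualCone hs hs' ht
  rw [← hu] at hin
  have := le_sub_of_selfConcordant (T := 1)
    (ψ := fun t : ℝ => -(u (dualPoint K F (s + t • u))))
    (φ := fun t => u ((hess F (dualPoint K F (s + t • u))).inverse u))
    (φ' := fun t => fderiv ℝ (hess F) (dualPoint K F (s + t • u))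
        ((hess F (dualPoint K F (s + t • u))).inverse u)
        ((hess F (dualPoint K F (s + t • u))).inverse u)
        ((hess F (dualPoint K F (s + t • u))).inverse u)) zero_le_one
    (fun t ht => by
      have hX : HasDerivAt (fun τ : ℝ => dualPoint K F (s + τ • u))
          (-((hess F (dualPoint K F (s + t • u))).inverse u)) t :=
        HasFDerivAt.comp_hasDerivAt (l := dualPoint K F) (f := fun τ : ℝ => s + τ • u) t
          (hF.hasFDerivAt_dualPoint hK (hin t ht)) (hasDerivAt_add_smul s u t)
      have hu : HasDerivAt (fun τ : ℝ => u (dualPoint K F (s + τ • u)))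
          (u (-((hess F (dualPoint K F (s + t • u))).inverse u))) t :=
        u.hasFDerivAt.comp_hasDerivAt t hX
      simpa using hu.fun_neg)
    (fun t ht => hF.hasDerivAt_dual_form hK (hin t ht) u)
    (fun t ht => (hF.isPosDef_hess hK (hF.dualPoint_spec hK (hin t ht)).1).inverse_pos h0)
    (fun t ht => hF.abs_deriv_dual_form_self_le hK (hin t ht) u)
  simp only [zero_smul, add_zero, one_smul, mul_one] at this
  rw [show √(u ((hess F (dualPoint K F s)).inverse u)) = r from hr.symm,
    ← (hF.isPosDef_hess hK (hF.dualPoint_spec hK hs).1).sq_opDualNorm, ← hr, hu,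
    add_sub_cancel, ← hu] at this
  linarith

/-- Comparison of the dual quadratic forms at two points of the dual cone. -/
theorem dual_form_comparison (hK : IsRegularCone K) (hF : IsNormalBarrier K ν F)
    (hs : s ∈ interior (dualCone K)) (hs' : s' ∈ interior (dualCone K)) {r : ℝ}
    (hr : r = opDualNorm (hess F (dualPoint K F s)) (s' - s)) (hr1 : r < 1)
    (k : StrongDual ℝ E) :
    (1 - r) ^ 3 * k ((hess F (dualPoint K F s)).inverse k) ≤
        k ((hess F (dualPoint K F s')).inverse k) ∧
      (1 - r) ^ 3 * k ((hess F (dualPoint K F s')).inverse k) ≤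
        k ((hess F (dualPoint K F s)).inverse k) := by
  rcases eq_or_ne (s' - s) 0 with h0 | h0
  · have hr0 : r = 0 := by simp [hr, h0, opDualNorm]
    rw [sub_eq_zero.1 h0, hr0]
    simp
  set u := s' - s with hu
  have hin := fun t (ht : t ∈ Icc (0 : ℝ) 1) => segment_mem_interior_dualCone hs hs' ht
  rw [← hu] at hin
  have hr0 : 0 ≤ r := by rw [hr]; exact opDualNorm_nonneg _ _
  set φ := fun t : ℝ => k ((hess F (dualPoint K F (s + t • u))).inverse k) with hφ
  set φ' := fun t : ℝ => fderiv ℝ (hess F) (dualPoint K F (s + t • u))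
        ((hess F (dualPoint K F (s + t • u))).inverse u)
        ((hess F (dualPoint K F (s + t • u))).inverse k)
        ((hess F (dualPoint K F (s + t • u))).inverse k) with hφ'
  have hder : ∀ t ∈ Icc (0 : ℝ) 1, HasDerivAt φ (φ' t) t := fun t ht =>
    hF.hasDerivAt_dual_form hK (hin t ht) k
  have hnn : ∀ t ∈ Icc (0 : ℝ) 1, 0 ≤ φ t := fun t ht =>
    (hF.isPosDef_hess hK (hF.dualPoint_spec hK (hin t ht)).1).inverse_nonneg k
  have hpos : ∀ t ∈ Icc (0 : ℝ) 1, 0 < 1 - r * t := fun t ht => by nlinarith [ht.1, ht.2]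
  -- The local norm of `u` at time `t` is at most `r / (1 - r t)`, and 3 is the trilinear constant.
  -- Hence `φ / (1 - r t)³` increases and `φ (1 - r t)³` decreases.
  have hb : ∀ t ∈ Icc (0 : ℝ) 1, |φ' t| ≤ 3 * (r / (1 - r * t)) * φ t := by
    intro t ht
    refine (hF.abs_deriv_dual_form_le hK (hin t ht) u k).trans ?_
    have hsub : Icc 0 t ⊆ Icc (0 : ℝ) 1 := Icc_subset_Icc_right ht.2
    have h0r : √(u ((hess F (dualPoint K F (s + (0 : ℝ) • u))).inverse u)) = r := by
      rw [zero_smul, add_zero]; exact hr.symm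
    have := sqrt_le_of_selfConcordant ht.1
      (φ := fun t => u ((hess F (dualPoint K F (s + t • u))).inverse u))
      (fun τ hτ => hF.hasDerivAt_dual_form hK (hin τ (hsub hτ)) u)
      (fun τ hτ =>
        (hF.isPosDef_hess hK (hF.dualPoint_spec hK (hin τ (hsub hτ))).1).inverse_pos h0)
      (fun τ hτ => hF.abs_deriv_dual_form_self_le hK (hin τ (hsub hτ)) u)
      (by rw [h0r]; linarith [hpos t ht])
    rw [h0r] at this
    have := hnn t ht
    change _ ≤ 3 * (r / (1 - r * t)) * φ t
    gcongr
  have hlin : ∀ t : ℝ, HasDerivAt (fun t : ℝ => (1 - r * t)) (-r) t := fun t => by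
    simpa using ((hasDerivAt_id t).const_mul r).const_sub 1
  have hφ0 : φ 0 = k ((hess F (dualPoint K F s)).inverse k) := by simp [hφ]
  have hφ1 : φ 1 = k ((hess F (dualPoint K F s')).inverse k) := by simp [hφ, hu]
  have hcube : ∀ t : ℝ, HasDerivAt (fun t : ℝ => (1 - r * t) ^ 3)
      (3 * (1 - r * t) ^ 2 * -r) t := fun t => by
    simpa using (hlin t).fun_pow 3
  rw [← hφ0, ← hφ1]
  constructor
  · have hmono : MonotoneOn (fun t => φ t / (1 - r * t) ^ 3) (Icc 0 1) := by
      have hd : ∀ t ∈ Icc (0 : ℝ) 1, HasDerivAt (fun t => φ t / (1 - r * t) ^ 3)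
          ((φ' t * (1 - r * t) ^ 3 - φ t * (3 * (1 - r * t) ^ 2 * -r)) /
            ((1 - r * t) ^ 3) ^ 2) t := fun t ht =>
        (hder t ht).fun_div (hcube t) (pow_ne_zero 3 (hpos t ht).ne')
      refine monotoneOn_of_hasDerivWithinAt_nonneg (convex_Icc 0 1)
        (fun t ht => (hd t ht).continuousAt.continuousWithinAt)
        (fun t ht => (hd t (interior_subset ht)).hasDerivWithinAt) fun t ht => ?_
      have ht := interior_subset ht
      have hp := hpos t ht
      have h1 := (abs_le.1 (hb t ht)).1
      refine div_nonneg ?_ (by positivity)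
      have h2 : 3 * (r / (1 - r * t)) * φ t * (1 - r * t) ^ 3 =
          3 * (1 - r * t) ^ 2 * r * φ t := by field_simp
      nlinarith [mul_le_mul_of_nonneg_right h1 (pow_pos hp 3).le]
    have := hmono (left_mem_Icc.2 zero_le_one) (right_mem_Icc.2 zero_le_one) zero_le_one
    simp only [mul_zero, sub_zero, one_pow, div_one, mul_one] at this
    rw [le_div_iff₀ (by have : 0 < 1 - r := by linarith
                        positivity)] at this
    linarith
  · have hanti : AntitoneOn (fun t => φ t * (1 - r * t) ^ 3) (Icc 0 1) := by
      have hd : ∀ t ∈ Icc (0 : ℝ) 1, HasDerivAt (fun t => φ t * (1 - r * t) ^ 3)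
          (φ' t * (1 - r * t) ^ 3 + φ t * (3 * (1 - r * t) ^ 2 * -r)) t := fun t ht =>
        (hder t ht).mul (hcube t)
      refine antitoneOn_of_hasDerivWithinAt_nonpos (convex_Icc 0 1)
        (fun t ht => (hd t ht).continuousAt.continuousWithinAt)
        (fun t ht => (hd t (interior_subset ht)).hasDerivWithinAt) fun t ht => ?_
      have ht := interior_subset ht
      have hp := hpos t ht
      have h1 := (abs_le.1 (hb t ht)).2
      have h2 : 3 * (r / (1 - r * t)) * φ t * (1 - r * t) ^ 3 =
          3 * (1 - r * t) ^ 2 * r * φ t := by field_simp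
      nlinarith [mul_le_mul_of_nonneg_right h1 (pow_pos hp 3).le]
    have := hanti (left_mem_Icc.2 zero_le_one) (right_mem_Icc.2 zero_le_one) zero_le_one
    simp only [mul_zero, sub_zero, one_pow, mul_one] at this
    linarith

/-- Stability of the Hessian of the dual barrier, for points at distance at most
`β / (1 - β)` with `β ≤ 1 / 9`. -/
theorem opNorm_inverse_sub_le (hK : IsRegularCone K) (hF : IsNormalBarrier K ν F)
    (hs : s ∈ interior (dualCone K)) (hs' : s' ∈ interior (dualCone K)) {β : ℝ}
    (hβ0 : 0 ≤ β) (hβ1 : β ≤ 1 / 9)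
    (hr : opDualNorm (hess F (dualPoint K F s)) (s' - s) ≤ β / (1 - β)) (z : StrongDual ℝ E) :
    opNorm (hess F (dualPoint K F s'))
        ((hess F (dualPoint K F s)).inverse z - (hess F (dualPoint K F s')).inverse z) ≤
      6 * β * opDualNorm (hess F (dualPoint K F s')) z := by
  have hP := hF.isPosDef_hess hK (hF.dualPoint_spec hK hs).1
  have hP' := hF.isPosDef_hess hK (hF.dualPoint_spec hK hs').1
  refine hP'.opNorm_apply_le_of_abs_le (ε := 6 * β)
    (D := (hess F (dualPoint K F s)).inverse - (hess F (dualPoint K F s')).inverse)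
    (fun g k => ?_) (fun k => ?_) z
  · simp only [sub_apply, map_sub]
    rw [hP.inverse_symm, hP'.inverse_symm]
  set r := opDualNorm (hess F (dualPoint K F s)) (s' - s) with hrdef
  have hr0 : 0 ≤ r := opDualNorm_nonneg _ _
  rw [le_div_iff₀ (by linarith)] at hr
  have hr1 : r < 1 := by nlinarith
  obtain ⟨h1, h2⟩ := hF.dual_form_comparison hK hs hs' hrdef hr1 k
  have ha := hP.inverse_nonneg k
  have ha' := hP'.inverse_nonneg k
  set a := k ((hess F (dualPoint K F s)).inverse k) with hadef
  set a' := k ((hess F (dualPoint K F s')).inverse k) with hadef'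
  have hc1 : (1 - r) ^ 3 ≤ 1 := pow_le_one₀ (by linarith) (by linarith)
  have hc0 : 0 < (1 - r) ^ 3 := pow_pos (by linarith) 3
  -- From `r ≤ β / (1 - β)` one has `1 - r ≥ (1 - 2β) / (1 - β)`. The remaining polynomial
  -- inequality has difference `β (3 - 27β + β² (65 - 48β))`, nonnegative thanks to `β ≤ 1/9`.
  have hc : 1 ≤ (1 + 6 * β) * (1 - r) ^ 3 := by
    have h3 : 1 - 2 * β ≤ (1 - r) * (1 - β) := by nlinarith
    have h4 := pow_le_pow_left₀ (by linarith) h3 3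
    rw [mul_pow] at h4
    have h5 : (1 - β) ^ 3 ≤ (1 + 6 * β) * (1 - 2 * β) ^ 3 := by
      have h6 : 0 ≤ β * ((3 - 27 * β) + β ^ 2 * (65 - 48 * β)) := by
        have h7 : 0 ≤ 3 - 27 * β := by linarith
        have h8 : 0 ≤ 65 - 48 * β := by linarith
        positivity
      nlinarith
    have h9 : 0 < (1 - β) ^ 3 := pow_pos (by linarith) 3
    refine le_of_mul_le_mul_right ?_ h9
    calc 1 * (1 - β) ^ 3 ≤ (1 + 6 * β) * (1 - 2 * β) ^ 3 := by linarith
      _ ≤ (1 + 6 * β) * ((1 - r) ^ 3 * (1 - β) ^ 3) := by gcongr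
      _ = _ := by ring
  rw [sub_apply, map_sub, ← hadef, ← hadef', abs_le]
  generalize (1 - r) ^ 3 = q at *
  constructor
  · have : (1 - q) * a' ≤ 6 * β * a' := by
      refine mul_le_mul_of_nonneg_right ?_ ha'
      nlinarith
    linarith
  · have h3 : a' ≤ (1 + 6 * β) * q * a' := by nlinarith
    have h4 : q * a ≤ q * ((1 + 6 * β) * a') := by nlinarith
    have h5 := le_of_mul_le_mul_left h4 hc0
    linarith

end Segment

end IsNormalBarrier

end Comparison

/-! ### The dual problem, the central path and its neighbourhood -/

section Problem

variable {E H : Type*} [NormedAddCommGroup E] [NormedSpace ℝ E]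
  [NormedAddCommGroup H] [NormedSpace ℝ H] {K : Set E} {ν : ℝ} {F : E → ℝ}
  {A : E →L[ℝ] StrongDual ℝ H} {b : StrongDual ℝ H} {c : StrongDual ℝ E}

theorem hasFDerivAt_slack (A : E →L[ℝ] StrongDual ℝ H) (c : StrongDual ℝ E) (y : H) :
    HasFDerivAt (slack A c) (-A.flip) y :=
  A.flip.hasFDerivAt.const_sub c

theorem continuous_slack (A : E →L[ℝ] StrongDual ℝ H) (c : StrongDual ℝ E) :
    Continuous (slack A c) :=
  continuous_const.sub A.flip.continuous

theorem slack_add (A : E →L[ℝ] StrongDual ℝ H) (c : StrongDual ℝ E) (y h : H) :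
    slack A c (y + h) = slack A c y - A.flip h := by
  rw [slack, slack, map_add, sub_sub]

theorem slack_sub_slack (A : E →L[ℝ] StrongDual ℝ H) (c : StrongDual ℝ E) (y z : H) :
    slack A c y - slack A c z = -A.flip (y - z) := by
  rw [slack, slack, map_sub]; abel

theorem isClosed_feasible (K : Set E) (A : E →L[ℝ] StrongDual ℝ H) (c : StrongDual ℝ E) :
    IsClosed (feasible K A c) :=
  (isClosed_dualCone K).preimage (continuous_slack A c)

theorem convex_feasible (K : Set E) (A : E →L[ℝ] StrongDual ℝ H) (c : StrongDual ℝ E) :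
    Convex ℝ (feasible K A c) := by
  intro y hy z hz p q hp hq hpq
  have h : slack A c (p • y + q • z) = p • slack A c y + q • slack A c z := by
    rw [slack, slack, slack, map_add, map_smul, map_smul, smul_sub, smul_sub]
    conv_lhs => rw [← one_smul ℝ c, ← hpq, add_smul]
    abel
  change slack A c (p • y + q • z) ∈ dualCone K
  rw [h]
  exact convex_dualCone K hy hz hp hq hpq

/-- Moving slightly from `y` away from the strictly feasible `y₀` stays in `Q`, so the slack of `y`
is a convex combination, with positive weight on `s₀`, of `s₀` and a point of the dual cone. -/
theorem slack_mem_interior_dualCone (hfeas : StrictlyFeasible K A b c) {y : H}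
    (hy : y ∈ interior (feasible K A c)) : slack A c y ∈ interior (dualCone K) := by
  obtain ⟨-, -, s₀, hs₀, y₀, -, hc⟩ := hfeas
  have hs₀' : slack A c y₀ = s₀ := by rw [slack, ← hc, add_sub_cancel_right]
  have hx' : y + (0 : ℝ) • (y - y₀) ∈ interior (feasible K A c) := by simpa using hy
  have hlim : Tendsto (fun t : ℝ => y + t • (y - y₀)) (𝓝[>] 0) (𝓝 (y + (0 : ℝ) • (y - y₀))) :=
    ((by fun_prop : Continuous fun t : ℝ => y + t • (y - y₀)).tendsto 0).mono_left
      nhdsWithin_le_nhds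
  obtain ⟨t, ht, ht0⟩ := ((hlim.eventually (isOpen_interior.mem_nhds hx')).and
    self_mem_nhdsWithin).exists
  have ht0 : 0 < t := ht0
  have ht : y + t • (y - y₀) ∈ interior (feasible K A c) := ht
  have hz : y + t • (y - y₀) ∈ feasible K A c := interior_subset ht
  have h1 := (convex_dualCone K).combo_interior_self_mem_interior hs₀ hz
    (a := t / (1 + t)) (b := 1 / (1 + t)) (by positivity) (by positivity) (by field_simp; ring)
  have h2 : (t / (1 + t)) • s₀ + (1 / (1 + t)) • slack A c (y + t • (y - y₀)) = slack A c y := by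
    rw [← hs₀']
    simp only [slack, map_add, map_smul, map_sub]
    match_scalars <;> field_simp <;> ring
  rwa [h2] at h1

/-- Feasible steps in a convex set from a point close to a feasible one. -/
theorem one_div_step_mem {Q : Set H} (hQ : Convex ℝ Q) {M : H →L[ℝ] StrongDual ℝ H}
    (hM : IsPosDef M) {y v ystar : H} (hdikin : ∀ u, opNorm M u ≤ 1 → y + u ∈ Q)
    (hystar : ystar ∈ Q) {ρ : ℝ} (hρ : 0 ≤ ρ) (he : opNorm M (y + v - ystar) ≤ ρ) :
    y + (1 / (1 + ρ)) • v ∈ Q := by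
  rcases hρ.eq_or_lt with h0 | h0
  · have := hM.eq_zero_of_opNorm_le (he.trans h0.symm.le)
    rw [← h0]
    simpa [sub_eq_zero.1 this] using hystar
  -- Weighting this point by `ρ / (1 + ρ)` and `y_*` by `1 / (1 + ρ)` cancels `y_*` and leaves `y +
  -- v / (1 + ρ)`.
  · have h1 : y + ρ⁻¹ • (y + v - ystar) ∈ Q := hdikin _ (by
      rw [opNorm_smul, abs_of_pos (inv_pos.2 h0), inv_mul_le_iff₀ h0]
      linarith)
    have h2 := hQ hystar h1 (a := 1 / (1 + ρ)) (b := ρ / (1 + ρ)) (by positivity) (by positivity)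
      (by field_simp)
    convert h2 using 1
    match_scalars <;> field_simp <;> ring

namespace IsCentralPoint

variable {t : ℝ} {z : E × StrongDual ℝ E × H}

theorem slack_eq (hz : IsCentralPoint K F A b c t z) : slack A c z.2.2 = z.2.1 := by
  rw [slack, hz.2.2.2, ← hz.2.2.1]
  abel

theorem sub_eq (hz : IsCentralPoint K F A b c t z) (u w : H) :
    b u - b w = slack A c w z.1 - slack A c u z.1 := by
  rw [← hz.2.1]
  simp [slack]

theorem slack_eq_neg_fderiv (hK : IsRegularCone K) (hF : IsNormalBarrier K ν F) (ht : 0 < t)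
    (hz : IsCentralPoint K F A b c t z) :
    slack A c z.2.2 = -fderiv ℝ F (t⁻¹ • z.1) := by
  rw [hz.slack_eq, hz.2.2.2, ← hF.fderiv_smul hK hz.1 (inv_pos.2 ht), smul_smul,
    mul_inv_cancel₀ ht.ne', one_smul]

theorem slack_apply_self (hF : IsNormalBarrier K ν F)
    (hz : IsCentralPoint K F A b c t z) : slack A c z.2.2 z.1 = t * ν := by
  rw [hz.slack_eq, hz.2.2.2, neg_apply, smul_apply, hF.fderiv_apply_self hz.1]
  simp

end IsCentralPoint

variable [FiniteDimensional ℝ E]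

namespace IsNormalBarrier

variable {y : H}

theorem hasFDerivAt_dualObjBarrier (hK : IsRegularCone K) (hF : IsNormalBarrier K ν F)
    (hy : slack A c y ∈ interior (dualCone K)) :
    HasFDerivAt (dualObjBarrier K F A c) (A (dualPoint K F (slack A c y))) y := by
  have h := HasFDerivAt.comp (g := dualBarrier K F) (f := slack A c) y
    (hF.hasFDerivAt_dualBarrier hK hy) (hasFDerivAt_slack A c y)
  convert! h using 1
  ext u
  simp

theorem fderiv_dualObjBarrier (hK : IsRegularCone K) (hF : IsNormalBarrier K ν F)
    (hy : slack A c y ∈ interior (dualCone K)) :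
    fderiv ℝ (dualObjBarrier K F A c) y = A (dualPoint K F (slack A c y)) :=
  (hF.hasFDerivAt_dualObjBarrier hK hy).fderiv

theorem hess_dualObjBarrier (hK : IsRegularCone K) (hF : IsNormalBarrier K ν F)
    (hy : slack A c y ∈ interior (dualCone K)) :
    hess (dualObjBarrier K F A c) y =
      A ∘L (hess F (dualPoint K F (slack A c y))).inverse ∘L A.flip := by
  have h1 := HasFDerivAt.comp (g := dualPoint K F) (f := slack A c) y
    (hF.hasFDerivAt_dualPoint hK hy) (hasFDerivAt_slack A c y)
  have h2 := HasFDerivAt.comp (g := A) y A.hasFDerivAt h1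
  have h3 : fderiv ℝ (dualObjBarrier K F A c) =ᶠ[𝓝 y] A ∘ dualPoint K F ∘ slack A c := by
    filter_upwards [(continuous_slack A c).continuousAt.preimage_mem_nhds
      (isOpen_interior.mem_nhds hy)] with z hz using hF.fderiv_dualObjBarrier hK hz
  rw [hess, (h2.congr_of_eventuallyEq h3).fderiv]
  ext u v
  simp

theorem isPosDef_hess_dualObjBarrier [FiniteDimensional ℝ H] (hK : IsRegularCone K)
    (hF : IsNormalBarrier K ν F) (hA : Function.Surjective A)
    (hy : slack A c y ∈ interior (dualCone K)) : IsPosDef (hess (dualObjBarrier K F A c) y) := by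
  rw [hF.hess_dualObjBarrier hK hy]
  exact (hF.isPosDef_hess hK (hF.dualPoint_spec hK hy).1).congruence A (flip_injective hA)

/-- The closed Dikin ellipsoid of the dual problem lies in the feasible set. -/
theorem add_mem_feasible (hK : IsRegularCone K) (hF : IsNormalBarrier K ν F)
    (hy : slack A c y ∈ interior (dualCone K)) {u : H}
    (hu : opNorm (hess (dualObjBarrier K F A c) y) u ≤ 1) : y + u ∈ feasible K A c := by
  have hspec := hF.dualPoint_spec hK hy
  refine hF.mem_dualCone_of_opDualNorm_le_one hK hspec.1 ?_
  rw [hF.hess_dualObjBarrier hK hy, opNorm_congruence] at hu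
  have h1 : fderiv ℝ F (dualPoint K F (slack A c y)) = -slack A c y := by
    rw [← neg_eq_iff_eq_neg]; exact hspec.2
  have h2 : slack A c (y + u) + fderiv ℝ F (dualPoint K F (slack A c y)) = -A.flip u := by
    rw [slack_add, h1]
    abel
  rwa [h2, opDualNorm_neg]

theorem exists_isCentralPoint [FiniteDimensional ℝ H] (hK : IsRegularCone K)
    (hF : IsNormalBarrier K ν F) (hA : Function.Surjective A) (hfeas : StrictlyFeasible K A b c)
    {t : ℝ} (ht : 0 < t) : ∃ z, IsCentralPoint K F A b c t z := by
  obtain ⟨x₀, hx₀, s₀, hs₀, y₀, hb, hc⟩ := hfeas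
  obtain ⟨x, hx, hxb, hker⟩ := hF.exists_forall_ker hK
    (smul_mem_interior_dualCone hs₀ (inv_pos.2 ht)) A hx₀
  obtain ⟨w, hw⟩ := exists_flip_eq_of_ker hA (g := s₀ + t • fderiv ℝ F x) fun h hh => by
    have h1 := hker h hh
    simp only [smul_apply, add_apply, smul_eq_mul] at h1 ⊢
    have h2 : s₀ h + t * fderiv ℝ F x h = t * (t⁻¹ * s₀ h + fderiv ℝ F x h) := by
      field_simp
    rw [h2, h1, mul_zero]
  refine ⟨(x, -(t • fderiv ℝ F x), w + y₀), hx, hxb.trans hb, ?_, rfl⟩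
  simp only
  rw [map_add, hw, ← hc]
  abel

end IsNormalBarrier

theorem isCentralPoint_centralPath [FiniteDimensional ℝ H] (hK : IsRegularCone K)
    (hF : IsNormalBarrier K ν F) (hA : Function.Surjective A) (hfeas : StrictlyFeasible K A b c)
    {t : ℝ} (ht : 0 < t) : IsCentralPoint K F A b c t (centralPath K F A b c t) :=
  Classical.epsilon_spec (hF.exists_isCentralPoint hK hA hfeas ht)

namespace IsCentralPoint

variable {t : ℝ} {z : E × StrongDual ℝ E × H}

theorem slack_mem_interior (hK : IsRegularCone K) (hF : IsNormalBarrier K ν F) (ht : 0 < t)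
    (hz : IsCentralPoint K F A b c t z) : slack A c z.2.2 ∈ interior (dualCone K) := by
  rw [hz.slack_eq_neg_fderiv hK hF ht]
  exact hF.neg_fderiv_mem_interior_dualCone hK (hK.smul_mem_interior hz.1 (inv_pos.2 ht))

theorem dualPoint_slack (hK : IsRegularCone K) (hF : IsNormalBarrier K ν F) (ht : 0 < t)
    (hz : IsCentralPoint K F A b c t z) : dualPoint K F (slack A c z.2.2) = t⁻¹ • z.1 := by
  rw [hz.slack_eq_neg_fderiv hK hF ht]
  exact hF.dualPoint_neg_fderiv hK (hK.smul_mem_interior hz.1 (inv_pos.2 ht))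

end IsCentralPoint

/-- Distance to the central path, the Newton decrement, and the optimality gap, for points of the
neighbourhood of the central path. -/
theorem nbhd_estimates [FiniteDimensional ℝ H] (hK : IsRegularCone K) (hF : IsNormalBarrier K ν F)
    (hA : Function.Surjective A) (hfeas : StrictlyFeasible K A b c) {μ β : ℝ} (hμ : 0 < μ)
    (hβ0 : 0 ≤ β) (hβ1 : β ≤ 1 / 9) {y : H} (hy : y ∈ nbhd K F A b c μ β)
    {z : E × StrongDual ℝ E × H} (hz : IsCentralPoint K F A b c μ z) :
    opDualNorm (hess F (dualPoint K F (slack A c y))) (slack A c z.2.2 - slack A c y) ≤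
        β / (1 - β) ∧
      opDualNorm (hess (dualObjBarrier K F A c) y)
          (fderiv ℝ (dualObjBarrier K F A c) y) ≤ √ν ∧
      ∀ u ∈ feasible K A c, b u - b y ≤ kappa1 ν β * μ := by
  have hs := slack_mem_interior_dualCone hfeas hy.1
  have hsz := hz.slack_mem_interior hK hF hμ
  have hx := (hF.dualPoint_spec hK hs).1
  have hB := hF.isPosDef_hess hK hx
  have hinj := flip_injective hA
  have hM := hF.isPosDef_hess_dualObjBarrier hK hA hs
  have hgrad := hF.fderiv_dualObjBarrier hK hs
  have hnb : opDualNorm (hess (dualObjBarrier K F A c) y)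
    (fderiv ℝ (dualObjBarrier K F A c) y - (1 / μ) • b) ≤ β := hy.2
  have hrM : opDualNorm (hess F (dualPoint K F (slack A c y))) (slack A c z.2.2 - slack A c y) =
      opNorm (hess (dualObjBarrier K F A c) y) (z.2.2 - y) := by
    rw [slack_sub_slack, opDualNorm_neg, hF.hess_dualObjBarrier hK hs, opNorm_congruence]
  have hmono := hF.div_le_apply_dualPoint_sub hK hs hsz hrM.symm
  have hdiff := hM.abs_dual_apply_le
    (fderiv ℝ (dualObjBarrier K F A c) y - (1 / μ) • b) (z.2.2 - y)
  have hlam : opDualNorm (hess (dualObjBarrier K F A c) y)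
      (fderiv ℝ (dualObjBarrier K F A c) y) ≤ √ν := by
    rw [hF.hess_dualObjBarrier hK hs, hgrad]
    refine (hB.opDualNorm_congruence_le A hinj _).trans ?_
    exact Real.le_sqrt_of_sq_le (hF.sq_opNorm_self hK hx).le
  have hr0 := opNorm_nonneg (hess (dualObjBarrier K F A c) y) (z.2.2 - y)
  -- At the central point `∇f = b / μ`, since `x_μ / μ` is its dual point. Strong monotonicity of
  -- `∇f` then gives `r² / (1 + r) ≤ β r`, that is `r ≤ β (1 + r)`.
  have hr : opNorm (hess (dualObjBarrier K F A c) y) (z.2.2 - y) ≤ β / (1 - β) := by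
    have e1 : (slack A c z.2.2 - slack A c y) (dualPoint K F (slack A c y)) -
        (slack A c z.2.2 - slack A c y) (dualPoint K F (slack A c z.2.2)) =
        -((fderiv ℝ (dualObjBarrier K F A c) y - (1 / μ) • b) (z.2.2 - y)) := by
      rw [hz.dualPoint_slack hK hF hμ, slack_sub_slack, hgrad, ← hz.2.1]
      simp
      ring
    rw [e1] at hmono
    set r := opNorm (hess (dualObjBarrier K F A c) y) (z.2.2 - y)
    have h1 : r ^ 2 / (1 + r) ≤ β * r := by
      refine hmono.trans ((neg_le_abs _).trans (hdiff.trans ?_))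
      gcongr
    rw [div_le_iff₀ (by positivity)] at h1
    rw [le_div_iff₀ (by linarith)]
    rcases hr0.eq_or_lt with h0 | h0
    · rw [← h0]; simpa using hβ0
    · have : r * r ≤ r * (β * (1 + r)) := by nlinarith
      have := le_of_mul_le_mul_left this h0
      linarith
  refine ⟨hrM ▸ hr, hlam, fun u hu => ?_⟩
  -- The gap splits at `y_μ`: the central part is at most `⟨s_μ, x_μ⟩ = μ ν`, and the part from `y`
  -- to `y_μ` is at most `‖b‖_y ‖y_μ - y‖_y`.
  have h1 : b u - b z.2.2 ≤ μ * ν := by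
    rw [hz.sub_eq, hz.slack_apply_self hF]
    have := hu z.1 (interior_subset hz.1)
    linarith
  have h2 : opDualNorm (hess (dualObjBarrier K F A c) y) b ≤ μ * (β + √ν) := by
    have e : b = μ • (fderiv ℝ (dualObjBarrier K F A c) y +
        -(fderiv ℝ (dualObjBarrier K F A c) y - (1 / μ) • b)) := by
      rw [neg_sub, add_sub_cancel, smul_smul, mul_one_div_cancel hμ.ne', one_smul]
    rw [e, opDualNorm_smul, abs_of_pos hμ]
    gcongr
    refine (hM.opDualNorm_add_le _ _).trans ?_
    rw [opDualNorm_neg]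
    linarith
  have h3 := (le_abs_self _).trans (hM.abs_dual_apply_le b (z.2.2 - y))
  have h4 : opDualNorm (hess (dualObjBarrier K F A c) y) b *
      opNorm (hess (dualObjBarrier K F A c) y) (z.2.2 - y) ≤
      μ * (β + √ν) * (β / (1 - β)) := by
    have := Real.sqrt_nonneg ν
    gcongr
  rw [map_sub] at h3
  have h5 : kappa1 ν β * μ = μ * ν + μ * (β + √ν) * (β / (1 - β)) := by
    rw [kappa1]; ring
  linarith

/-- Sharpness bounds the metric `G` by the local metric. -/
theorem opNorm_metricG_le [FiniteDimensional ℝ H] (hK : IsRegularCone K)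
    (hF : IsNormalBarrier K ν F) (hA : Function.Surjective A) {y : H}
    (hs : slack A c y ∈ interior (dualCone K)) {G : H →L[ℝ] StrongDual ℝ H} (hG : IsPosDef G)
    {γ δ f : ℝ} (hγ : 0 < γ) {ystar : H}
    (hsharp : ∀ u ∈ feasible K A c, γ * opNorm G (u - ystar) ≤ f - b u)
    (hδ : f - b y ≤ δ) (h : H) :
    opNorm G h ≤ δ / γ * opNorm (hess (dualObjBarrier K F A c) y) h := by
  rcases eq_or_ne h 0 with rfl | hh
  · simp [opNorm]
  have hM := hF.isPosDef_hess_dualObjBarrier hK hA hs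
  have hn := hM.opNorm_pos hh
  set n := opNorm (hess (dualObjBarrier K F A c) y) h with hndef
  -- Sharpness is used at opposite points `y ± h / n` of the Dikin ellipsoid. In the sum the terms
  -- in `b h` cancel, leaving twice the gap at `y`.
  have h1 := hsharp _ (hF.add_mem_feasible hK hs (u := n⁻¹ • h) (by
    rw [opNorm_smul, abs_of_pos (inv_pos.2 hn), ← hndef, inv_mul_cancel₀ hn.ne']))
  have h2 := hsharp _ (hF.add_mem_feasible hK hs (u := -(n⁻¹ • h)) (by
    rw [opNorm_neg, opNorm_smul, abs_of_pos (inv_pos.2 hn), ← hndef, inv_mul_cancel₀ hn.ne']))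
  have h3 := hG.opNorm_add_le (y + n⁻¹ • h - ystar) (-(y + -(n⁻¹ • h) - ystar))
  have h4 : y + n⁻¹ • h - ystar + -(y + -(n⁻¹ • h) - ystar) = (2 * n⁻¹) • h := by module
  rw [h4, opNorm_neg, opNorm_smul, abs_of_pos (by positivity)] at h3
  rw [map_add] at h1 h2
  rw [map_neg] at h2
  have h5 : γ * (2 * n⁻¹ * opNorm G h) ≤ 2 * δ := by nlinarith
  rw [div_mul_eq_mul_div, le_div_iff₀ hγ]
  have h6 : n * (γ * (2 * n⁻¹ * opNorm G h)) = 2 * (opNorm G h * γ) := by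
    field_simp
  nlinarith [mul_le_mul_of_nonneg_left h5 hn.le]

/-- Transfer of the bound on `∇²F_*(s) s_*` from the central path to its neighbourhood. -/
theorem opNorm_inverse_slack_le (hK : IsRegularCone K)
    (hF : IsNormalBarrier K ν F) {μ β : ℝ} (hμ0 : 0 < μ) (hμ1 : μ ≤ 1)
    (hβ0 : 0 ≤ β) (hβ1 : β ≤ 1 / 9) {s : StrongDual ℝ E} (hs : s ∈ interior (dualCone K))
    {z₁ z : E × StrongDual ℝ E × H} (hz₁ : IsCentralPoint K F A b c 1 z₁)
    (hz : IsCentralPoint K F A b c μ z) {ystar : H} (hystar : IsOptimal K A b c ystar)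
    (hr : opDualNorm (hess F (dualPoint K F s)) (slack A c z.2.2 - s) ≤ β / (1 - β)) {σ : ℝ}
    (hσ : opNorm (hess F z₁.1) (ofBidual (hess (dualBarrier K F) z.2.1 (slack A c ystar))) ≤ σ) :
    opNorm (hess F z₁.1) ((hess F (dualPoint K F s)).inverse (slack A c ystar)) ≤
      σ + 12 * ν ^ 2 * β / μ := by
  have hsz := hz.slack_mem_interior hK hF hμ0
  have hν := hF.parameter_nonneg hK
  have hB := hF.isPosDef_hess hK hz₁.1
  have hstab := hF.opNorm_inverse_sub_le hK hs hsz hβ0 hβ1 hr (slack A c ystar)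
  rw [← hz.slack_eq, hF.ofBidual_hess_dualBarrier hK hsz] at hσ
  have hX := hz.dualPoint_slack hK hF hμ0
  have hxm := (hF.dualPoint_spec hK hsz).1
  -- The dual norm of `s_*` is at most `⟨s_*, x_μ⟩ / μ`, and `⟨s_*, x_μ⟩ ≤ ⟨s_μ, x_μ⟩ = μ ν` by
  -- optimality of `y_*`.
  have h1 : opDualNorm (hess F (dualPoint K F (slack A c z.2.2))) (slack A c ystar) ≤ ν := by
    refine (hF.opDualNorm_le_apply hK hxm hystar.1).trans ?_
    have hfz : slack A c z.2.2 ∈ dualCone K := interior_subset hsz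
    have h2 := hz.sub_eq ystar z.2.2
    have h3 := hystar.2 _ hfz
    rw [hz.slack_apply_self hF] at h2
    rw [hX, map_smul, smul_eq_mul, inv_mul_le_iff₀ hμ0]
    linarith
  -- The left side is `⟨s_1, x_μ⟩ / μ`. Orthogonality of `s_1 - s_μ` and `x_1 - x_μ` gives `⟨s_1,
  -- x_μ⟩ = ν + μ ν - ⟨s_μ, x_1⟩ ≤ 2 ν`, using `μ ≤ 1`.
  have h2 : -fderiv ℝ F z₁.1 (dualPoint K F (slack A c z.2.2)) ≤ 2 * ν / μ := by
    have e1 : slack A c z₁.2.2 = -fderiv ℝ F z₁.1 := by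
      rw [hz₁.slack_eq, hz₁.2.2.2, one_smul]
    have e2 : slack A c z₁.2.2 z.1 - slack A c z.2.2 z.1 =
        slack A c z₁.2.2 z₁.1 - slack A c z.2.2 z₁.1 := by
      rw [← hz.sub_eq, ← hz₁.sub_eq]
    rw [hz.slack_apply_self hF, hz₁.slack_apply_self hF] at e2
    have e3 : 0 ≤ slack A c z.2.2 z₁.1 := interior_subset hsz _ (interior_subset hz₁.1)
    have e4 := congrArg (fun g => g z.1) e1
    simp only [neg_apply] at e4
    rw [hX, map_smul, smul_eq_mul, le_div_iff₀ hμ0]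
    have e5 : -(μ⁻¹ * fderiv ℝ F z₁.1 z.1) * μ = -fderiv ℝ F z₁.1 z.1 := by field_simp
    rw [e5, ← e4]
    nlinarith
  set d := (hess F (dualPoint K F s)).inverse (slack A c ystar) -
    (hess F (dualPoint K F (slack A c z.2.2))).inverse (slack A c ystar) with hd
  have h3 := hF.opNorm_le_mul_opNorm hK hz₁.1 hxm d
  have h4 : opNorm (hess F z₁.1) d ≤ 2 * ν / μ * (6 * β * ν) := by
    refine h3.trans ?_
    have := opNorm_nonneg (hess F (dualPoint K F (slack A c z.2.2))) d
    calc _ ≤ 2 * ν / μ * opNorm (hess F (dualPoint K F (slack A c z.2.2))) d := by gcongr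
      _ ≤ _ := by
        gcongr
        refine hstab.trans ?_
        gcongr
  have h5 := hB.opNorm_add_le
    ((hess F (dualPoint K F (slack A c z.2.2))).inverse (slack A c ystar)) d
  rw [hd, add_sub_cancel, ← hd] at h5
  have h6 : 2 * ν / μ * (6 * β * ν) = 12 * ν ^ 2 * β / μ := by ring
  linarith

/-- The error of the predictor direction: `y + v(y) - y_*` is the solution of a linear system
with the right-hand side `A ∇²F_*(s) s_*`. -/
theorem add_predDir_sub [FiniteDimensional ℝ H] (hK : IsRegularCone K)
    (hF : IsNormalBarrier K ν F) (hA : Function.Surjective A) {y : H}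
    (hs : slack A c y ∈ interior (dualCone K)) (ystar : H) :
    y + predDir K F A c y - ystar = (hess (dualObjBarrier K F A c) y).inverse
      (A ((hess F (dualPoint K F (slack A c y))).inverse (slack A c ystar))) := by
  have hspec := hF.dualPoint_spec hK hs
  have hB := hF.isPosDef_hess hK hspec.1
  have hM := hF.isPosDef_hess_dualObjBarrier hK hA hs
  -- Homogeneity: `∇²F(x) x = -∇F(x) = s`.
  have h1 : (hess F (dualPoint K F (slack A c y))).inverse (slack A c y) =
      dualPoint K F (slack A c y) := by
    have h := hB.inverse_apply (dualPoint K F (slack A c y))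
    rwa [hF.hess_apply_self hK hspec.1, hspec.2] at h
  have h2 : hess (dualObjBarrier K F A c) y (ystar - y) =
      fderiv ℝ (dualObjBarrier K F A c) y -
        A ((hess F (dualPoint K F (slack A c y))).inverse (slack A c ystar)) := by
    rw [hF.hess_dualObjBarrier hK hs, hF.fderiv_dualObjBarrier hK hs]
    have h3 : A.flip (ystar - y) = slack A c y - slack A c ystar := by
      rw [slack_sub_slack, ← map_neg, neg_sub]
    simp only [ContinuousLinearMap.comp_apply]
    rw [h3, map_sub, h1, map_sub]
  have h4 := congrArg (hess (dualObjBarrier K F A c) y).inverse h2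
  rw [hM.inverse_apply, map_sub] at h4
  rw [predDir, add_sub_right_comm, ← neg_sub ystar y, h4]
  abel

end Problem

/-! ### Upper bound on the feasible steps -/

section Step

variable {E H : Type*} [NormedAddCommGroup E] [NormedSpace ℝ E]
  [NormedAddCommGroup H] [NormedSpace ℝ H] {K : Set E} {F : E → ℝ}
  {A : E →L[ℝ] StrongDual ℝ H} {b : StrongDual ℝ H} {c : StrongDual ℝ E}

/-- An upper bound on the steps that do not increase the objective beyond its optimal value. -/
theorem step_sub_one_le [FiniteDimensional ℝ H] {M : H →L[ℝ] StrongDual ℝ H} (hM : IsPosDef M)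
    {y v ystar : H} {μ β ρ α : ℝ} (hμ : 0 < μ) (hβ : 0 ≤ β) (hρ : 0 ≤ ρ) (hρβ : ρ < 1 - 2 * β)
    (he : opNorm M (y + v - ystar) ≤ ρ) (hv : 1 - ρ ≤ opNorm M v)
    (hb : opDualNorm M (M v - (1 / μ) • b) ≤ β) (hα : b (y + α • v) ≤ b ystar) :
    α - 1 ≤ ρ / (1 - ρ - 2 * β) := by
  set l := opNorm M v with hl
  have hd : 0 < 1 - ρ - 2 * β := by linarith
  have hbe : b = μ • (M v + -(M v - (1 / μ) • b)) := by
    rw [neg_sub, add_sub_cancel, smul_smul, mul_one_div_cancel hμ.ne', one_smul]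
  have hbn : opDualNorm M b ≤ μ * (l + β) := by
    rw [hbe, opDualNorm_smul, abs_of_pos hμ]
    gcongr
    refine (hM.opDualNorm_add_le _ _).trans ?_
    rw [opDualNorm_neg, hM.opDualNorm_apply]
    linarith
  have hbv : μ * (l * (l - β)) ≤ b v := by
    have h1 := (abs_le.1 (hM.abs_dual_apply_le (M v - (1 / μ) • b) v)).2
    have h2 : opDualNorm M (M v - (1 / μ) • b) * l ≤ β * l := by
      have := opNorm_nonneg M v
      gcongr
    rw [sub_apply, smul_apply, smul_eq_mul, ← hM.sq_opNorm, ← hl] at h1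
    have h3 : b v = μ * (1 / μ * b v) := by field_simp
    rw [h3]
    refine mul_le_mul_of_nonneg_left ?_ hμ.le
    nlinarith
  have hbe' : -b (y + v - ystar) ≤ μ * (l + β) * ρ := by
    refine (neg_le_abs _).trans ((hM.abs_dual_apply_le b _).trans ?_)
    have := opNorm_nonneg M (y + v - ystar)
    have := (opDualNorm_nonneg M b).trans hbn
    gcongr
  -- `y + α v` equals `y_*` plus the error `y + v - y_*` plus `(α - 1) v`, and its objective value
  -- does not exceed that of `y_*`.
  have hkey : (α - 1) * b v ≤ μ * (l + β) * ρ := by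
    refine le_trans ?_ hbe'
    simp only [map_add, map_sub, map_smul, smul_eq_mul] at hα ⊢
    linarith
  rw [le_div_iff₀ hd]
  rcases le_total α 1 with h | h
  · nlinarith
  · have h1 : (α - 1) * (l * (l - β)) ≤ (l + β) * ρ := by
      have h2 : (α - 1) * (μ * (l * (l - β))) ≤ (α - 1) * b v :=
        mul_le_mul_of_nonneg_left hbv (by linarith)
      have h3 : μ * ((α - 1) * (l * (l - β))) ≤ μ * ((l + β) * ρ) := by linarith
      exact le_of_mul_le_mul_left h3 hμ
    -- Since `1 - ρ ≤ l`, the left side is at most `(l + β) (l - 2β) = l (l - β) - 2β²`.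
    have h4 : (l + β) * (1 - ρ - 2 * β) ≤ l * (l - β) := by nlinarith
    have h5 : 0 < l + β := by linarith
    have h6 : (l + β) * ((α - 1) * (1 - ρ - 2 * β)) ≤ (l + β) * ρ := by
      nlinarith [mul_le_mul_of_nonneg_left h4 (sub_nonneg.2 h)]
    exact le_of_mul_le_mul_left h6 h5

theorem isClosed_feasibleSteps (y : H) : IsClosed (feasibleSteps K F A c y) :=
  isClosed_Ici.inter ((isClosed_feasible K A c).preimage
    (by fun_prop : Continuous fun α : ℝ => y + α • predDir K F A c y))

theorem maxStep_eq_of_isGreatest {y : H} {α : ℝ} (h : IsGreatest (feasibleSteps K F A c y) α) :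
    maxStep K F A c y = α :=
  (EReal.coe_strictMono.monotone.map_isGreatest h).csSup_eq

/-- A sharp solution is at local distance at least one from every strictly feasible point. -/
theorem one_le_opNorm_sub [Nontrivial H] {Q : Set H} {M G : H →L[ℝ] StrongDual ℝ H}
    (hM : IsPosDef M) (hG : IsPosDef G) {y ystar : H}
    (hdikin : ∀ u, opNorm M u ≤ 1 → y + u ∈ Q) {γ : ℝ} (hγ : 0 < γ)
    (hsharp : ∀ u ∈ Q, γ * opNorm G (u - ystar) ≤ b ystar - b u) :
    1 ≤ opNorm M (ystar - y) := by
  by_contra! hlt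
  obtain ⟨h, hh⟩ := exists_ne (0 : H)
  have hn := hM.opNorm_pos hh
  set ε := (1 - opNorm M (ystar - y)) / opNorm M h with hε
  have hε0 : 0 < ε := div_pos (by linarith) hn
  have hεn : ε * opNorm M h = 1 - opNorm M (ystar - y) := div_mul_cancel₀ _ hn.ne'
  -- If `y_*` were inside the open Dikin ellipsoid, both `y_* ± ε h` would be feasible; sharpness
  -- would force `b` to decrease in both directions.
  have key : ∀ u, opNorm M u = opNorm M h → γ * (ε * opNorm G u) ≤ -(ε * b u) := by
    intro u hu
    have h1 := hsharp _ (hdikin (ystar - y + ε • u) (by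
      refine (hM.opNorm_add_le _ _).trans ?_
      rw [opNorm_smul, abs_of_pos hε0, hu]
      linarith))
    have h2 : y + (ystar - y + ε • u) = ystar + ε • u := by abel
    rw [h2, add_sub_cancel_left, opNorm_smul, abs_of_pos hε0, map_add, map_smul,
      smul_eq_mul] at h1
    linarith
  have h1 := key h rfl
  have h2 := key (-h) (opNorm_neg M h)
  rw [opNorm_neg, map_neg] at h2
  have h3 : 0 < γ * (ε * opNorm G h) := mul_pos hγ (mul_pos hε0 (hG.opNorm_pos hh))
  linarith

end Step

end ConicIPM

/-! ### The main theorem -/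

theorem mainTheorem6
    {E H : Type*} [NormedAddCommGroup E] [NormedSpace ℝ E] [FiniteDimensional ℝ E]
    [NormedAddCommGroup H] [NormedSpace ℝ H] [FiniteDimensional ℝ H] [Nontrivial H]
    (K : Set E) (hK : ConicIPM.IsRegularCone K)
    (ν : ℝ) (F : E → ℝ) (hF : ConicIPM.IsNormalBarrier K ν F)
    (A : E →L[ℝ] StrongDual ℝ H) (hA : Function.Surjective A)
    (b : StrongDual ℝ H) (c : StrongDual ℝ E)
    (hfeas : ConicIPM.StrictlyFeasible K A b c)
    (ystar : H) (hystar : ConicIPM.IsOptimal K A b c ystar)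
    (γ : ℝ) (hγ : 0 < γ) (hsharp : ConicIPM.SharpDual K F A b c γ ystar)
    (σ : ℝ) (hbound : ConicIPM.BoundedDual K F A b c σ ystar)
    (μ β : ℝ) (hμ0 : 0 < μ) (hμ1 : μ ≤ 1) (hβ0 : 0 ≤ β) (hβ1 : β ≤ 1 / 9)
    (y : H) (hy : y ∈ ConicIPM.nbhd K F A b c μ β)
    (κ : ℝ) (hκ : κ = ConicIPM.kappa ν γ σ μ β) :
    (1 : EReal) - ConicIPM.maxStep K F A c y ≤ ((κ * μ / (1 + κ * μ) : ℝ) : EReal) ∧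
    (κ * μ < 1 - 2 * β →
      IsGreatest (ConicIPM.feasibleSteps K F A c y) (ConicIPM.maxStep K F A c y).toReal ∧
      ConicIPM.maxStep K F A c y - 1 ≤ ((κ * μ / (1 - κ * μ - 2 * β) : ℝ) : EReal) ∧
      ConicIPM.localNorm (ConicIPM.dualObjBarrier K F A c) y
          (y + (ConicIPM.maxStep K F A c y).toReal • ConicIPM.predDir K F A c y - ystar)
        ≤ κ * μ * (1 + Real.sqrt ν / (1 - κ * μ - 2 * β))) := by
  open ConicIPM in
  have hz₁ := isCentralPoint_centralPath hK hF hA hfeas one_pos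
  have hz := isCentralPoint_centralPath hK hF hA hfeas hμ0
  have hs := slack_mem_interior_dualCone hfeas hy.1
  have hM := hF.isPosDef_hess_dualObjBarrier hK hA hs
  have hinj := flip_injective hA
  have hB : IsPosDef (metricB K F A b c) := hF.isPosDef_hess hK hz₁.1
  have hG : IsPosDef (metricG K F A b c) := hB.congruence A hinj
  have hν := hF.parameter_nonneg hK
  have hσ0 : 0 ≤ σ := (opNorm_nonneg _ _).trans (hbound 1 one_pos le_rfl)
  obtain ⟨hr, hlam, hgap⟩ := nbhd_estimates hK hF hA hfeas hμ0 hβ0 hβ1 hy hz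
  have hopt : optValue K A b c = b ystar :=
    IsGreatest.csSup_eq ⟨⟨ystar, hystar.1, rfl⟩, by rintro _ ⟨u, hu, rfl⟩; exact hystar.2 u hu⟩
  have hsharp' : ∀ u ∈ feasible K A c,
      γ * opNorm (metricG K F A b c) (u - ystar) ≤ b ystar - b u := fun u hu =>
    hopt ▸ hsharp u hu
  have hdikin : ∀ u, opNorm (hess (dualObjBarrier K F A c) y) u ≤ 1 → y + u ∈ feasible K A c :=
    fun u hu => hF.add_mem_feasible hK hs hu
  have hk1 : 0 ≤ kappa1 ν β := by
    have : 0 ≤ 1 - β := by linarith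
    have := Real.sqrt_nonneg ν
    rw [kappa1]
    positivity
  have hρ : 0 ≤ κ * μ := by
    rw [hκ, kappa, kappa2]
    positivity
  have hw := opNorm_inverse_slack_le hK hF hμ0 hμ1 hβ0 hβ1 hs hz₁ hz hystar hr (hbound μ hμ0 hμ1)
  set w := (hess F (dualPoint K F (slack A c y))).inverse (slack A c ystar) with hwdef
  have he : opNorm (hess (dualObjBarrier K F A c) y)
      (y + predDir K F A c y - ystar) ≤ κ * μ := by
    rw [add_predDir_sub hK hF hA hs, hM.opNorm_inverse, ← hwdef]
    have h1 := hG.opDualNorm_le_of_opNorm_le hM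
      (opNorm_metricG_le hK hF hA hs hG hγ hsharp' (hgap ystar hystar.1)) (A w)
    have h2 := hB.opDualNorm_congruence_le A hinj w
    calc _ ≤ kappa1 ν β * μ / γ * opDualNorm (metricG K F A b c) (A w) := h1
      _ ≤ kappa1 ν β * μ / γ * (σ + 12 * ν ^ 2 * β / μ) := by
        gcongr
        exact h2.trans hw
      -- The error bound needs only `σ` where `κ₂` allows `2 σ`; the hypothesis at `t = 1` shows
      -- that `σ` is nonnegative.
      _ ≤ kappa1 ν β * μ / γ * (2 * (σ + 6 * ν ^ 2 / μ * β)) := by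
        gcongr
        have : 12 * ν ^ 2 * β / μ = 2 * (6 * ν ^ 2 / μ * β) := by ring
        linarith
      _ = κ * μ := by rw [hκ, kappa, kappa2]; ring
  have hstep : 1 / (1 + κ * μ) ∈ feasibleSteps K F A c y :=
    ⟨by positivity, one_div_step_mem (convex_feasible K A c) hM hdikin hystar.1 hρ he⟩
  have hmax : ((1 / (1 + κ * μ) : ℝ) : EReal) ≤ maxStep K F A c y :=
    le_sSup ⟨_, hstep, rfl⟩
  have hone : 1 - 1 / (1 + κ * μ) = κ * μ / (1 + κ * μ) := by
    field_simp
    ring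
  refine ⟨?_, fun hsmall => ?_⟩
  · refine (EReal.sub_le_sub le_rfl hmax).trans_eq ?_
    rw [← hone]
    norm_cast
  have hgradv : hess (dualObjBarrier K F A c) y (predDir K F A c y) =
      fderiv ℝ (dualObjBarrier K F A c) y := hM.apply_inverse _
  have hvnorm : opNorm (hess (dualObjBarrier K F A c) y) (predDir K F A c y) ≤ √ν := by
    rw [predDir, hM.opNorm_inverse]; exact hlam
  have hv1 : 1 - κ * μ ≤ opNorm (hess (dualObjBarrier K F A c) y) (predDir K F A c y) := by
    have h1 := one_le_opNorm_sub hM hG hdikin hγ hsharp'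
    have h2 := hM.opNorm_add_le (predDir K F A c y) (-(y + predDir K F A c y - ystar))
    rw [opNorm_neg, show predDir K F A c y + -(y + predDir K F A c y - ystar) = ystar - y by
      abel] at h2
    linarith
  have hub : ∀ α ∈ feasibleSteps K F A c y, α - 1 ≤ κ * μ / (1 - κ * μ - 2 * β) := fun α hα =>
    step_sub_one_le hM hμ0 hβ0 hρ hsmall he hv1 (by rw [hgradv]; exact hy.2)
      (hystar.2 _ hα.2)
  have hgr : IsGreatest (feasibleSteps K F A c y) (sSup (feasibleSteps K F A c y)) :=
    (isClosed_feasibleSteps y).isGreatest_csSup ⟨_, hstep⟩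
      ⟨1 + κ * μ / (1 - κ * μ - 2 * β), fun α hα => by linarith [hub α hα]⟩
  set α := sSup (feasibleSteps K F A c y)
  rw [maxStep_eq_of_isGreatest hgr, EReal.toReal_coe]
  have hα := hub α hgr.1
  have hd : 0 < 1 - κ * μ - 2 * β := by linarith
  refine ⟨hgr, by exact_mod_cast hα, ?_⟩
  -- The maximal step may also be shorter than 1; then `1 - α ≤ ρ / (1 + ρ)` with `ρ = κ μ`, which
  -- is below the same bound.
  have hα' : |α - 1| ≤ κ * μ / (1 - κ * μ - 2 * β) := by
    refine abs_le.2 ⟨?_, hα⟩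
    have h1 := hgr.2 hstep
    have h2 : κ * μ / (1 + κ * μ) ≤ κ * μ / (1 - κ * μ - 2 * β) := by
      gcongr
      linarith
    linarith
  have hsplit : y + α • predDir K F A c y - ystar =
      (y + predDir K F A c y - ystar) + (α - 1) • predDir K F A c y := by module
  rw [localNorm, hsplit]
  refine (hM.opNorm_add_le _ _).trans ?_
  rw [opNorm_smul]
  calc _ ≤ κ * μ + κ * μ / (1 - κ * μ - 2 * β) * √ν := by
        have := opNorm_nonneg (hess (dualObjBarrier K F A c) y) (predDir K F A c y)
        gcongr
    _ = _ := by ring
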